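/- All multigraphs are finite; parallel edges are allowed. An incidence of a loopless multigraph $G$ is a pair $(v,e)$ where $v$ is an endpoint of the edge $e$. Two distinct incidences $(u,e)$ and $(v,f)$ are adjacent if $u=v$, or $e=f$, or at least one of the edges $e$, $f$ has endpoints $u$ and $v$. An incidence coloring of $G$ assigns a color to every incidence so that adjacent incidences receive different colors. The multigraph $G$ is incidence $k$-choosable if for every assignment of a $k$-element set $L(v,e)$ of colors to each incidence $(v,e)$ there is an incidence coloring $\varphi$ with $\varphi(v,e)\in L(v,e)$ for all incidences $(v,e)$; the incidence choice number $ch_i(G)$ is the least integer $k\ge 0$ such that $G$ is incidence $k$-choosable. Theorem. Every loopless multigraph $G$ in which every vertex has degree at most $3$ is incidence $6$-choosable, and therefore $ch_i(G)\le 6$. The bound is tight: the loopless subcubic multigraph $T$ with two vertices and three parallel edges joining them satisfies $ch_i(T)=6$. -/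

import Mathlib

universe w u v

namespace Graph

/-- The incidences of a multigraph `G`: the pairs `(x, e)` where `x` is an end of the edge `e`. -/
abbrev Incidence {α : Type u} {β : Type v} (G : Graph α β) : Type (max u v) :=
  {p : α × β // G.Inc p.2 p.1}

/-- Two distinct incidences `(x, e)` and `(y, f)` are adjacent if `x = y`, or `e = f`, or one of
the edges `e`, `f` has ends `x` and `y`. -/
def IncidenceAdj {α : Type u} {β : Type v} (G : Graph α β) (i j : G.Incidence) : Prop :=
  i ≠ j ∧ (i.1.1 = j.1.1 ∨ i.1.2 = j.1.2 ∨
    G.IsLink i.1.2 i.1.1 j.1.1 ∨ G.IsLink j.1.2 i.1.1 j.1.1)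

/-- A colouring of the incidences such that adjacent incidences get different colours. -/
def IsIncidenceColoring {α : Type u} {β : Type v} (G : Graph α β) {C : Type w}
    (φ : G.Incidence → C) : Prop :=
  ∀ i j : G.Incidence, G.IncidenceAdj i j → φ i ≠ φ j

/-- `G` is incidence `L`-choosable: some incidence colouring takes its values in the lists. -/
def IncidenceListColorable {α : Type u} {β : Type v} (G : Graph α β) {C : Type w}
    (L : G.Incidence → Finset C) : Prop :=
  ∃ φ : G.Incidence → C, G.IsIncidenceColoring φ ∧ ∀ i, φ i ∈ L i

/-- `G` is incidence `k`-choosable: it is incidence `L`-choosable for every assignment `L` of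
`k`-element lists. Colours come from arbitrary types (in the universe `w`). -/
def IncidenceChoosable {α : Type u} {β : Type v} (G : Graph α β) (k : ℕ) : Prop :=
  ∀ (C : Type w) (L : G.Incidence → Finset C), (∀ i, (L i).card = k) →
    G.IncidenceListColorable L

/-- The incidence choice number: the least `k` such that `G` is incidence `k`-choosable
(`⊤` if there is no such `k`). -/
noncomputable def incidenceChoiceNumber {α : Type u} {β : Type v} (G : Graph α β) : ℕ∞ :=
  ⨅ (k : ℕ) (_ : IncidenceChoosable.{w} G k), (k : ℕ∞)

/-- The degree of `x`: the number of edges incident with `x`, each loop at `x` counted twice. -/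
noncomputable def multiDegree {α : Type u} {β : Type v} (G : Graph α β) (x : α) : ℕ∞ :=
  {e | G.Inc e x}.encard + {e | G.IsLoopAt e x}.encard

/-- Every vertex has degree at most three. -/
def IsSubcubic {α : Type u} {β : Type v} (G : Graph α β) : Prop :=
  ∀ x ∈ G.vertexSet, G.multiDegree x ≤ 3

/-- The multigraph with two vertices `0`, `1` and three parallel edges joining them. -/
def tripleEdge : Graph (Fin 2) (Fin 3) where
  vertexSet := Set.univ
  edgeSet := Set.univ
  IsLink _ x y := x ≠ y
  isLink_symm _ _ := ⟨fun _ _ h => h.symm⟩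
  eq_or_eq_of_isLink_of_isLink := by
    intro e x y v w h₁ h₂
    omega
  edge_mem_iff_exists_isLink _ := ⟨fun _ => ⟨0, 1, by decide⟩, fun _ => trivial⟩
  left_mem_of_isLink _ _ _ _ := trivial

end Graph

/-! With incidences viewed as half-edges, those at the vertices of a set `W` are coloured by strong
induction on `W` (`HalfEdges.colorable_of_finset`). A vertex of degree at most two, a cubic vertex
with a neighbour outside `W`, or a triple edge is removed and afterwards coloured greedily.
Otherwise `W` is cubic and closed under taking neighbours, and a shortest closed walk yields a cycle
whose third edges all leave it. Once everything off the cycle is coloured, each incidence of a cycle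
edge keeps at least five colours and each outward incidence at least three, so all rests on a list
problem on a cycle (`solvable_of_card_le`).

Going round the cycle greedily is easy; closing up is the difficulty. For length at least three, if
no edge can serve as the closing edge, the lists are rigid (`lists_of_not_solvable`): the two lists
of an edge differ in at most one colour, and the second is also the first list of the next edge. So
much overlap lets colours be reused on nonadjacent incidences, which solves triangles and longer
cycles. Digons are coloured directly.

The bound is sharp because the six incidences of the triple edge are pairwise adjacent. -/

section

open Finset

/-! ### List colouring around a cycle: greedy steps and ways to close up. -/

namespace IncidenceCycle

variable {C : Type w}

/-- The three incidences at a vertex of a cycle get different colours. -/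
def Node (a b c : C) : Prop := a ≠ b ∧ c ≠ a ∧ c ≠ b

/-- The constraints between the colours `a, b` of an edge of a cycle and the colours `a', b'` of
the next edge and `c'` of the incidence pointing out of the cycle between them. -/
def Link (a b a' b' c' : C) : Prop := c' ≠ a ∧ c' ≠ b ∧ a' ≠ a ∧ a' ≠ b ∧ b' ≠ b

/-- The list colouring problem left on the incidences at an induced cycle of length `k`. -/
def Solvable {k : ℕ} (La Lb Lc : ZMod k → Finset C) : Prop :=
  ∃ a b c : ZMod k → C, (∀ i, a i ∈ La i ∧ b i ∈ Lb i ∧ c i ∈ Lc i) ∧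
    ∀ i, Node (a i) (b i) (c i) ∧ Link (a i) (b i) (a (i + 1)) (b (i + 1)) (c (i + 1))

theorem Solvable.mono {k : ℕ} {La Lb Lc La' Lb' Lc' : ZMod k → Finset C}
    (h : Solvable La Lb Lc) (ha : ∀ i, La i ⊆ La' i) (hb : ∀ i, Lb i ⊆ Lb' i)
    (hc : ∀ i, Lc i ⊆ Lc' i) : Solvable La' Lb' Lc' := by
  obtain ⟨a, b, c, hm, h⟩ := h
  exact ⟨a, b, c, fun i => ⟨ha i (hm i).1, hb i (hm i).2.1, hc i (hm i).2.2⟩, h⟩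

/-- Traversing the cycle in the opposite direction. -/
theorem Solvable.of_reflect {k : ℕ} {La Lb Lc : ZMod k → Finset C}
    (h : Solvable (fun i => Lb (-i)) (fun i => La (-i)) (fun i => Lc (1 - i))) :
    Solvable La Lb Lc := by
  obtain ⟨a, b, c, hm, h⟩ := h
  refine ⟨fun i => b (-i), fun i => a (-i), fun i => c (1 - i), fun i => ?_, fun i => ?_⟩
  · have h1 := hm (-i)
    have h2 := hm (1 - i)
    simp only [neg_neg, sub_sub_cancel] at h1 h2
    exact ⟨h1.2.1, h1.1, h2.2.2⟩
  · have h1 := h (-i)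
    have h2 := h (-(i + 1))
    have e1 : -(i + 1) + 1 = -i := by ring
    have e2 : -i + 1 = 1 - i := by ring
    have e3 : 1 - (i + 1) = -i := by ring
    rw [e1] at h2
    rw [e2] at h1
    simp only [e3]
    obtain ⟨⟨p1, p2, p3⟩, q1, q2, q3, q4, q5⟩ := h1
    obtain ⟨⟨r1, r2, r3⟩, s1, s2, s3, s4, s5⟩ := h2
    exact ⟨⟨p1.symm, q2, q1⟩, p3, p2, s5.symm, s4.symm, s3.symm⟩

/-- A cyclic colouring found by moving along the cycle from `i₀`, keeping the colours at the
`j`-th place within `S j`. -/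
theorem Solvable.of_states {n : ℕ} {La Lb Lc : ZMod (n + 1) → Finset C} (i₀ : ZMod (n + 1))
    (S : ℕ → C → C → C → Prop) (a₀ b₀ c₀ : C) (hS₀ : S 0 a₀ b₀ c₀)
    (hstep : ∀ j < n, ∀ a b c, S j a b c → ∃ a' b' c', S (j + 1) a' b' c' ∧ Link a b a' b' c')
    (hS : ∀ j ≤ n, ∀ a b c, S j a b c →
      (a ∈ La (i₀ + j) ∧ b ∈ Lb (i₀ + j) ∧ c ∈ Lc (i₀ + j)) ∧ Node a b c)
    (hwrap : ∀ a b c, S n a b c → Link a b a₀ b₀ c₀) : Solvable La Lb Lc := by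
  classical
  choose! fa fb fc hf using hstep
  let g : ℕ → C × C × C := fun j => Nat.rec (a₀, b₀, c₀)
    (fun j p => (fa j p.1 p.2.1 p.2.2, fb j p.1 p.2.1 p.2.2, fc j p.1 p.2.1 p.2.2)) j
  have hg : ∀ j ≤ n, S j (g j).1 (g j).2.1 (g j).2.2 := by
    intro j
    induction j with
    | zero => intro _; exact hS₀
    | succ j ih => intro hj; exact (hf j (by omega) _ _ _ (ih (by omega))).1
  have hl : ∀ j < n, Link (g j).1 (g j).2.1 (g (j + 1)).1 (g (j + 1)).2.1 (g (j + 1)).2.2 :=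
    fun j hj => (hf j hj _ _ _ (hg j hj.le)).2
  have hval : ∀ i : ZMod (n + 1), (i - i₀).val ≤ n := fun i => by
    have := ZMod.val_lt (i - i₀); omega
  have hcast : ∀ i : ZMod (n + 1), i₀ + ((i - i₀).val : ZMod (n + 1)) = i := fun i => by
    rw [ZMod.natCast_zmod_val]; ring
  refine ⟨fun i => (g (i - i₀).val).1, fun i => (g (i - i₀).val).2.1,
    fun i => (g (i - i₀).val).2.2, fun i => ?_, fun i => ⟨?_, ?_⟩⟩
  · have := (hS _ (hval i) _ _ _ (hg _ (hval i))).1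
    rwa [hcast] at this
  · exact (hS _ (hval i) _ _ _ (hg _ (hval i))).2
  · have e : i + 1 - i₀ = (i - i₀) + 1 := by ring
    simp only [e]
    rcases (hval i).lt_or_eq with h | h
    · have hv : (i - i₀ + 1).val = (i - i₀).val + 1 := by
        have := ZMod.val_cast_of_lt (n := n + 1) (a := (i - i₀).val + 1) (by omega)
        rwa [Nat.cast_succ, ZMod.natCast_zmod_val] at this
      rw [hv]
      exact hl _ h
    · have h0 : (i - i₀) + 1 = 0 := by
        have := ZMod.natCast_zmod_val (i - i₀)
        rw [h] at this
        rw [← this]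
        exact_mod_cast ZMod.natCast_self (n + 1)
      rw [h0, ZMod.val_zero, h]
      exact hwrap _ _ _ (hg n le_rfl)

variable [DecidableEq C]

theorem exists_mem_ne₂ {L : Finset C} (h : 3 ≤ #L) (x₁ x₂ : C) : ∃ y ∈ L, y ≠ x₁ ∧ y ≠ x₂ := by
  obtain ⟨y, hy, hn⟩ := exists_mem_notMem_of_card_lt_card (s := {x₁, x₂}) (t := L)
    (card_le_two.trans_lt h)
  exact ⟨y, hy, by simpa using hn⟩

theorem exists_mem_ne₃ {L : Finset C} (h : 4 ≤ #L) (x₁ x₂ x₃ : C) :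
    ∃ y ∈ L, y ≠ x₁ ∧ y ≠ x₂ ∧ y ≠ x₃ := by
  obtain ⟨y, hy, hn⟩ := exists_mem_notMem_of_card_lt_card (s := {x₁, x₂, x₃}) (t := L)
    (card_le_three.trans_lt h)
  exact ⟨y, hy, by simpa using hn⟩

theorem exists_mem_ne₄ {L : Finset C} (h : 5 ≤ #L) (x₁ x₂ x₃ x₄ : C) :
    ∃ y ∈ L, y ≠ x₁ ∧ y ≠ x₂ ∧ y ≠ x₃ ∧ y ≠ x₄ := by
  obtain ⟨y, hy, hn⟩ := exists_mem_notMem_of_card_lt_card (s := {x₁, x₂, x₃, x₄}) (t := L)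
    (card_le_four.trans_lt h)
  exact ⟨y, hy, by simpa using hn⟩

theorem card_sdiff_of_inter {L T : Finset C} {m n : ℕ} (hL : #L = m + n) (h : #(L ∩ T) ≤ n) :
    m ≤ #(L \ T) := by
  have := card_sdiff_add_card_inter L T
  omega

theorem le_card_sdiff_singleton {L : Finset C} {n : ℕ} (hL : n + 1 ≤ #L) (x : C) :
    n ≤ #(L \ {x}) := by
  have := le_card_sdiff {x} L
  simp only [card_singleton] at this
  omega

/-- One step along the cycle. -/
theorem exists_link {La Lb Lc : Finset C} (ha : 4 ≤ #La) (hb : 4 ≤ #Lb) (hc : 3 ≤ #Lc) (a b : C) :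
    ∃ a' b' c', (a' ∈ La ∧ b' ∈ Lb ∧ c' ∈ Lc) ∧ Node a' b' c' ∧ Link a b a' b' c' := by
  obtain ⟨c', hc', c1, c2⟩ := exists_mem_ne₂ hc a b
  obtain ⟨a', ha', a1, a2, a3⟩ := exists_mem_ne₃ ha a b c'
  obtain ⟨b', hb', b1, b2, b3⟩ := exists_mem_ne₃ hb b c' a'
  exact ⟨a', b', c', ⟨ha', hb', hc'⟩, ⟨b3.symm, a3.symm, b2.symm⟩, c1, c2, a1, a2, b1⟩

/-- A colouring around the cycle from the place `i`, where the edge before the last has to avoid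
`RA` and `RB` and the last edge is then coloured by hand. -/
theorem Solvable.of_close {m : ℕ} {La Lb Lc : ZMod (m + 3) → Finset C} (hLa : ∀ i, #(La i) = 5)
    (hLb : ∀ i, #(Lb i) = 5) (hLc : ∀ i, #(Lc i) = 3) (i : ZMod (m + 3)) (RA RB : Finset C)
    (hRA : 4 ≤ #(La (i - 2) \ RA)) (hRB : 4 ≤ #(Lb (i - 2) \ RB)) (a₁ b₁ c₁ : C)
    (hm : a₁ ∈ La i ∧ b₁ ∈ Lb i ∧ c₁ ∈ Lc i) (hn : Node a₁ b₁ c₁)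
    (hclose : ∀ p ∈ La (i - 2) \ RA, ∀ q ∈ Lb (i - 2) \ RB, p ≠ q → ∃ a b c,
      (a ∈ La (i - 1) ∧ b ∈ Lb (i - 1) ∧ c ∈ Lc (i - 1)) ∧ Node a b c ∧ Link p q a b c ∧
        Link a b a₁ b₁ c₁) : Solvable La Lb Lc := by
  have hk : (m : ZMod (m + 3)) + 3 = 0 := by exact_mod_cast ZMod.natCast_self (m + 3)
  have e1 : i + ((m + 1 : ℕ) : ZMod (m + 3)) = i - 2 := by push_cast; linear_combination hk
  have e2 : i + ((m + 2 : ℕ) : ZMod (m + 3)) = i - 1 := by push_cast; linear_combination hk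
  refine Solvable.of_states i (fun j a b c =>
    ((a ∈ La (i + j) ∧ b ∈ Lb (i + j) ∧ c ∈ Lc (i + j)) ∧ Node a b c) ∧
      (j = m + 1 → a ∉ RA ∧ b ∉ RB) ∧ (j = m + 2 → Link a b a₁ b₁ c₁)) a₁ b₁ c₁
    ⟨⟨by simpa using hm, hn⟩, by omega, by omega⟩ ?_ (fun j _ a b c h => h.1)
    (fun a b c h => h.2.2 rfl)
  rintro j hj a b c ⟨⟨⟨hma, hmb, -⟩, hnode⟩, hR, -⟩
  rcases lt_trichotomy j m with hjm | rfl | hjm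
  · obtain ⟨a', b', c', h1, h2, h3⟩ := exists_link (La := La (i + (j + 1 : ℕ)))
      (Lb := Lb (i + (j + 1 : ℕ))) (by rw [hLa]; omega) (by rw [hLb]; omega) (hLc (i + (j + 1 : ℕ))).ge a b
    exact ⟨a', b', c', ⟨⟨h1, h2⟩, by omega, by omega⟩, h3⟩
  · obtain ⟨a', b', c', h1, h2, h3⟩ := exists_link hRA hRB (hLc (i - 2)).ge a b
    simp only [mem_sdiff] at h1
    refine ⟨a', b', c', ⟨⟨?_, h2⟩, fun _ => ⟨h1.1.2, h1.2.1.2⟩, by omega⟩, h3⟩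
    rw [e1]
    exact ⟨h1.1.1, h1.2.1.1, h1.2.2⟩
  · obtain rfl : j = m + 1 := by omega
    rw [e1] at hma hmb
    obtain ⟨a', b', c', h1, h2, h3, h4⟩ := hclose a (mem_sdiff.2 ⟨hma, (hR rfl).1⟩) b
      (mem_sdiff.2 ⟨hmb, (hR rfl).2⟩) hnode.1
    exact ⟨a', b', c', ⟨⟨by rwa [e2], h2⟩, by omega, fun _ => h4⟩, h3⟩

/-- Edge `i` is coloured last and sees `γ₀`, `γ₁`, `α`, all fixed in advance. The bounds leave three
colours for its `a`, against `p` and `q`, and four for its `b`, against `q`, `b₁` and `a`. -/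
theorem Solvable.of_forward {m : ℕ} {La Lb Lc : ZMod (m + 3) → Finset C}
    (hLa : ∀ i, #(La i) = 5) (hLb : ∀ i, #(Lb i) = 5) (hLc : ∀ i, #(Lc i) = 3) (i : ZMod (m + 3))
    {γ₀ γ₁ α : C} (h₀ : γ₀ ∈ Lc i) (h₁ : γ₁ ∈ Lc (i + 1)) (hα : α ∈ La (i + 1)) (hne : α ≠ γ₁)
    (hA : #(La i ∩ {γ₀, γ₁, α}) ≤ 2) (hB : #(Lb i ∩ {γ₀, γ₁, α}) ≤ 1) : Solvable La Lb Lc := by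
  have e1 : i + 1 - 1 = i := by ring
  obtain ⟨b₁, hb₁, hb1, hb2⟩ := exists_mem_ne₂ (L := Lb (i + 1)) (by rw [hLb]; omega) α γ₁
  refine Solvable.of_close hLa hLb hLc (i + 1) {γ₀} {γ₀}
    (le_card_sdiff_singleton (hLa _).ge _) (le_card_sdiff_singleton (hLb _).ge _) α b₁ γ₁
    ⟨hα, hb₁, h₁⟩ ⟨hb1.symm, hne.symm, hb2.symm⟩ ?_
  simp only [mem_sdiff, mem_singleton, e1]
  rintro p ⟨-, hp⟩ q ⟨-, hq⟩ -
  obtain ⟨a, ha, ha1, ha2⟩ := exists_mem_ne₂ (card_sdiff_of_inter (m := 3) (hLa i) hA) p q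
  obtain ⟨b, hb, hb3, hb4, hb5⟩ :=
    exists_mem_ne₃ (card_sdiff_of_inter (m := 4) (hLb i) hB) q b₁ a
  simp only [mem_sdiff, mem_insert, mem_singleton, not_or, ← ne_eq] at ha hb
  exact ⟨a, b, γ₀, ⟨ha.1, hb.1, h₀⟩, ⟨hb5.symm, ha.2.1.symm, hb.2.1.symm⟩,
    ⟨Ne.symm hp, Ne.symm hq, ha1, ha2, hb3⟩, ha.2.2.1.symm, hb.2.2.1.symm, ha.2.2.2.symm,
    hb.2.2.2.symm, hb4.symm⟩

theorem Solvable.of_backward {m : ℕ} {La Lb Lc : ZMod (m + 3) → Finset C}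
    (hLa : ∀ i, #(La i) = 5) (hLb : ∀ i, #(Lb i) = 5) (hLc : ∀ i, #(Lc i) = 3) (i : ZMod (m + 3))
    {γ₀ γ₁ β : C} (h₀ : γ₀ ∈ Lc i) (h₁ : γ₁ ∈ Lc (i + 1)) (hβ : β ∈ Lb (i - 1)) (hne : β ≠ γ₀)
    (hB : #(Lb i ∩ {γ₁, γ₀, β}) ≤ 2) (hA : #(La i ∩ {γ₁, γ₀, β}) ≤ 1) : Solvable La Lb Lc := by
  have e1 : -(-i + 1) = i - 1 := by ring
  have e2 : 1 - (-i + 1) = i := by ring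
  have e3 : 1 - -i = i + 1 := by ring
  refine Solvable.of_reflect (Solvable.of_forward (fun i => hLb (-i)) (fun i => hLa (-i))
    (fun i => hLc (1 - i)) (-i) (γ₀ := γ₁) (γ₁ := γ₀) (α := β) ?_ ?_ ?_ hne ?_ ?_) <;>
  simpa only [e1, e2, e3, neg_neg]

/-- Here the incidence `b i` of the closing edge is also fixed in advance, as `β`. The previous edge
can keep clear of `γ₀`, and its `b` of `β` too, by `hF`; then `a i` has four colours left against
`p`, `q` and `a₁`. -/
theorem Solvable.of_split {m : ℕ} {La Lb Lc : ZMod (m + 3) → Finset C}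
    (hLa : ∀ i, #(La i) = 5) (hLb : ∀ i, #(Lb i) = 5) (hLc : ∀ i, #(Lc i) = 3) (i : ZMod (m + 3))
    {γ₀ γ₁ β : C} (h₀ : γ₀ ∈ Lc i) (h₁ : γ₁ ∈ Lc (i + 1)) (hβ : β ∈ Lb i) (hne₀ : β ≠ γ₀)
    (hne₁ : β ≠ γ₁) (hF : #(Lb (i - 1) ∩ {γ₀, β}) ≤ 1) (hA : #(La i ∩ {γ₀, γ₁, β}) ≤ 1) :
    Solvable La Lb Lc := by
  have e1 : i + 1 - 1 = i := by ring
  have e2 : i + 1 - 2 = i - 1 := by ring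
  obtain ⟨a₁, ha₁, ha1, ha2⟩ := exists_mem_ne₂ (L := La (i + 1)) (by rw [hLa]; omega) β γ₁
  obtain ⟨b₁, hb₁, hb1, hb2, hb3⟩ := exists_mem_ne₃ (L := Lb (i + 1)) (by rw [hLb]; omega) β γ₁ a₁
  refine Solvable.of_close hLa hLb hLc (i + 1) {γ₀} {γ₀, β}
    (le_card_sdiff_singleton (hLa _).ge _) (by rw [e2]; exact card_sdiff_of_inter (hLb _) hF)
    a₁ b₁ γ₁ ⟨ha₁, hb₁, h₁⟩ ⟨hb3.symm, ha2.symm, hb2.symm⟩ ?_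
  simp only [mem_sdiff, mem_singleton, mem_insert, not_or, e1]
  rintro p ⟨-, hp⟩ q ⟨-, hq⟩ -
  obtain ⟨a, ha, ha3, ha4, ha5⟩ :=
    exists_mem_ne₃ (card_sdiff_of_inter (m := 4) (hLa i) hA) p q a₁
  simp only [mem_sdiff, mem_insert, mem_singleton, not_or, ← ne_eq] at ha
  exact ⟨a, β, γ₀, ⟨ha.1, hβ, h₀⟩, ⟨ha.2.2.2, ha.2.1.symm, hne₀.symm⟩,
    ⟨Ne.symm hp, Ne.symm hq.1, ha3, ha4, Ne.symm hq.2⟩, ha.2.2.1.symm, hne₁.symm, ha5.symm,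
    ha1, hb1⟩

/-! ### Rigidity of lists that block every closing edge. -/

theorem card_inter_insert_le (L T : Finset C) (x : C) :
    #(L ∩ insert x T) ≤ (if x ∈ L then 1 else 0) + #(L ∩ T) := by
  split_ifs with hx
  · rw [inter_insert_of_mem hx, add_comm]
    exact card_insert_le _ _
  · rw [inter_insert_of_notMem hx, zero_add]

theorem card_inter_pair_le (L : Finset C) (x y : C) :
    #(L ∩ {x, y}) ≤ (if x ∈ L then 1 else 0) + (if y ∈ L then 1 else 0) := by
  have h₁ := card_inter_insert_le L {y} x
  have h₂ := card_inter_insert_le L ∅ y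
  simp only [insert_empty_eq, inter_empty, card_empty] at h₂
  omega

theorem card_inter_triple_le (L : Finset C) (x y z : C) :
    #(L ∩ {x, y, z}) ≤ (if x ∈ L then 1 else 0) + (if y ∈ L then 1 else 0) +
      (if z ∈ L then 1 else 0) := by
  have h₁ := card_inter_insert_le L {y, z} x
  have h₂ := card_inter_pair_le L y z
  omega

/-- No choice of a colour for the outward incidence before an edge (from `X`), for the outward
incidence after it (from `Y`) and for the next incidence on the cycle (from `E`) leaves enough
room in the lists `A` and `B` of the edge. -/
structure Blocked (A B X Y E : Finset C) : Prop where
  generic : ∀ γ₀ ∈ X, ∀ γ₁ ∈ Y, ∀ α ∈ E, α ≠ γ₁ → (γ₀ ∉ A ∨ γ₁ ∉ A ∨ α ∉ A) →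
    ¬ ((γ₀ ∉ B ∧ γ₁ ∉ B) ∨ (γ₀ ∉ B ∧ α ∉ B) ∨ (γ₁ ∉ B ∧ α ∉ B))
  left : ∀ s ∈ X, s ∈ E → ∀ γ₁ ∈ Y, s ≠ γ₁ → s ∈ B ∧ γ₁ ∈ B
  common : ∀ γ ∈ X, γ ∈ Y → ∀ α ∈ E, α ≠ γ → γ ∈ B ∧ α ∈ B

/-- When two of the three colours coincide, they take at most two colours from `A` in any case, so
the obstruction must come from `B`; this gives `left` and `common`. -/
theorem Blocked.of_card {A B X Y E : Finset C}
    (h : ∀ γ₀ ∈ X, ∀ γ₁ ∈ Y, ∀ α ∈ E, α ≠ γ₁ → #(A ∩ {γ₀, γ₁, α}) ≤ 2 →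
      ¬ #(B ∩ {γ₀, γ₁, α}) ≤ 1) : Blocked A B X Y E := by
  have hdup : ∀ x y : C, #(A ∩ {x, y}) ≤ 2 :=
    fun x y => (card_le_card inter_subset_right).trans card_le_two
  have hone : ∀ x y : C, ¬ #(B ∩ {x, y}) ≤ 1 → x ∈ B ∧ y ∈ B := by
    intro x y hxy
    have := card_inter_pair_le B x y
    split_ifs at this <;> first | exact ⟨‹_›, ‹_›⟩ | omega
  refine ⟨fun γ₀ h₀ γ₁ h₁ α hα hne hA hB => h γ₀ h₀ γ₁ h₁ α hα hne ?_ ?_,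
    fun s hs hsE γ₁ h₁ hne => ?_, fun γ hX hY α hα hne => ?_⟩
  · refine (card_inter_triple_le _ _ _ _).trans ?_
    split_ifs <;> first | omega | tauto
  · refine (card_inter_triple_le _ _ _ _).trans ?_
    split_ifs <;> first | omega | tauto
  · have e : ({s, γ₁, s} : Finset C) = {s, γ₁} := by ext; simp; tauto
    have := h s hs γ₁ h₁ s hsE hne
    rw [e] at this
    exact hone _ _ (this (hdup _ _))
  · have e : ({γ, γ, α} : Finset C) = {γ, α} := by simp
    have := h γ hX γ hY α hα hne
    rw [e] at this
    exact hone _ _ (this (hdup _ _))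

theorem card_add_card_le {P Q L : Finset C} (hPQ : Disjoint P Q) (hP : P ⊆ L) (hQ : Q ⊆ L) :
    #P + #Q ≤ #L := by
  rw [← card_union_of_disjoint hPQ]
  exact card_le_card (union_subset hP hQ)

/-- A colour `γ ∈ Y \ B` would force each `x ∈ X` and `α ∈ E.erase γ` to lie together in `B`, or
together with `γ` in `A`. As `X` and `E.erase γ` are then disjoint, two lists of size five are too
small for this. -/
theorem Blocked.subset_of_disjoint {A B X Y E : Finset C} (h : Blocked A B X Y E) (hA : #A = 5)
    (hB : #B = 5) (hX : #X = 3) (hE : #E = 5) (hXY : Disjoint X Y) : Y ⊆ B := by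
  intro γ hγ
  by_contra hγB
  have hXE : Disjoint X (E.erase γ) := by
    rw [disjoint_left]
    intro s hs hsE
    exact hγB (h.left s hs (mem_of_mem_erase hsE) γ hγ (ne_of_mem_erase hsE)).2
  have hE' : 4 ≤ #(E.erase γ) := by
    have := pred_card_le_card_erase (s := E) (a := γ); omega
  have hpair : ∀ x ∈ X, ∀ α ∈ E.erase γ, (x ∈ A ∧ γ ∈ A ∧ α ∈ A) ∨ (x ∈ B ∧ α ∈ B) := by
    intro x hx α hα
    have := h.generic x hx γ hγ α (mem_of_mem_erase hα) (ne_of_mem_erase hα)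
    tauto
  obtain ⟨α₀, hα₀⟩ : (E.erase γ).Nonempty := card_pos.1 (by omega)
  -- If `E.erase γ` fits in `Q`, at most one colour of `X` does too; the others, at least two, force
  -- `E.erase γ` into `P`, which would hold six colours.
  have key : ∀ P Q : Finset C, #P = 5 → #Q = 5 →
      (∀ x ∈ X, ∀ α ∈ E.erase γ, (x ∈ P ∧ α ∈ P) ∨ (x ∈ Q ∧ α ∈ Q)) → ¬ E.erase γ ⊆ Q := by
    intro P Q hP hQ hPQ hsub
    have h1 := card_add_card_le (hXE.mono_left inter_subset_left) inter_subset_right hsub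
      (P := X ∩ Q)
    have h2 := card_sdiff_add_card_inter X Q
    obtain ⟨x₀, hx₀⟩ : (X \ Q).Nonempty := card_pos.1 (by omega)
    have h3 := card_add_card_le (L := P) (hXE.mono_left sdiff_subset) (P := X \ Q)
      (fun x hx => by
        have := hPQ x (mem_sdiff.1 hx).1 α₀ hα₀
        have := (mem_sdiff.1 hx).2
        tauto)
      (fun α hα => by
        have := hPQ x₀ (mem_sdiff.1 hx₀).1 α hα
        have := (mem_sdiff.1 hx₀).2
        tauto)
    omega
  have hnB := key A B hA hB (fun x hx α hα => by have := hpair x hx α hα; tauto)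
  have hnA := key B A hB hA (fun x hx α hα => by have := hpair x hx α hα; tauto)
  have hXA : X ⊆ A := by
    intro x hx
    by_contra hxA
    exact hnB fun α hα => by have := hpair x hx α hα; tauto
  have hXB : X ⊆ B := by
    intro x hx
    by_contra hxB
    exact hnA fun α hα => by have := hpair x hx α hα; tauto
  obtain ⟨α, hα, hαB⟩ := not_subset.1 hnB
  obtain ⟨x, hx⟩ : X.Nonempty := card_pos.1 (by omega)
  have hγA : γ ∈ A := by have := hpair x hx α hα; tauto
  have hγX : γ ∉ X := fun hγX => disjoint_left.1 hXY hγX hγ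
  -- `A` contains `γ` and `X`, hence at most one colour of `E.erase γ`; `B` contains `X`, hence at
  -- most two. But `E.erase γ` has at least four.
  have h1 := card_add_card_le (L := A) (P := insert γ X) (Q := E.erase γ ∩ A)
    (by
      rw [disjoint_insert_left]
      exact ⟨by simp, hXE.mono_right inter_subset_left⟩)
    (insert_subset hγA hXA) inter_subset_right
  have h2 := card_add_card_le (L := B) (P := X) (Q := E.erase γ ∩ B)
    (hXE.mono_right inter_subset_left) hXB inter_subset_right
  have h3 : E.erase γ ⊆ (E.erase γ ∩ A) ∪ (E.erase γ ∩ B) := by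
    intro α hα
    have := hpair x hx α hα
    simp only [mem_union, mem_inter]
    tauto
  have h4 := (card_le_card h3).trans (card_union_le _ _)
  rw [card_insert_of_notMem hγX] at h1
  omega

theorem Blocked.eq_of_mem {A B X Y E : Finset C} (h : Blocked A B X Y E) (hB : #B = 5)
    (hE : #E = 5) {γ : C} (hX : γ ∈ X) (hY : γ ∈ Y) : γ ∈ B ∧ E = B := by
  obtain ⟨α, hα, hne, -⟩ := exists_mem_ne₂ (L := E) (by omega) γ γ
  have hγ := (h.common γ hX hY α hα hne).1
  refine ⟨hγ, eq_of_subset_of_card_le (fun β hβ => ?_) (by omega)⟩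
  by_cases hβγ : β = γ
  · rwa [hβγ]
  · exact (h.common γ hX hY β hβ hβγ).2

theorem Blocked.eq_of_disjoint {A B X Y E : Finset C} (h : Blocked A B X Y E) (hB : #B = 5)
    (hE : #E = 5) {γ₀ γ₁ : C} (hX : γ₀ ∈ X) (h₀ : γ₀ ∉ B) (hY : γ₁ ∈ Y) (h₁ : γ₁ ∈ B)
    (h₁' : γ₁ ∉ A) : E = B := by
  refine eq_of_subset_of_card_le (fun β hβ => ?_) (by omega)
  by_cases hβγ : β = γ₁
  · rwa [hβγ]
  · by_contra hβB
    exact h.generic γ₀ hX γ₁ hY β hβ hβγ (by tauto) (by tauto)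

theorem exists_mem_notMem_of_disjoint {X Y L : Finset C} (hX : #X = 3) (hY : #Y = 3) (hL : #L = 5)
    (hXY : Disjoint X Y) (hYL : Y ⊆ L) : ∃ γ ∈ X, γ ∉ L := by
  by_contra! hXL
  have := card_add_card_le hXY hXL hYL
  omega

/-- Both directions of travel block edge `i`, which gives `La (i + 1) = Lb i` and, in reverse, `Lb
(i - 1) = La i`. The second equality makes `of_split` available, and its failure bounds `Lb i \ La
i`. -/
theorem lists_of_not_solvable {m : ℕ} {La Lb Lc : ZMod (m + 3) → Finset C}
    (hLa : ∀ i, #(La i) = 5) (hLb : ∀ i, #(Lb i) = 5) (hLc : ∀ i, #(Lc i) = 3)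
    (hns : ¬ Solvable La Lb Lc) (i : ZMod (m + 3)) :
    La (i + 1) = Lb i ∧ Lc i ⊆ La i ∧ #(Lb i \ La i) ≤ 1 := by
  have hf : Blocked (La i) (Lb i) (Lc i) (Lc (i + 1)) (La (i + 1)) :=
    Blocked.of_card fun γ₀ h₀ γ₁ h₁ α hα hne hA hB =>
      hns (Solvable.of_forward hLa hLb hLc i h₀ h₁ hα hne hA hB)
  have hb : Blocked (Lb i) (La i) (Lc (i + 1)) (Lc i) (Lb (i - 1)) :=
    Blocked.of_card fun γ₁ h₁ γ₀ h₀ β hβ hne hB hA =>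
      hns (Solvable.of_backward hLa hLb hLc i h₀ h₁ hβ hne hB hA)
  -- A colour `β ∈ Lb i` outside `La i` and different from `γ₁` would allow `of_split`: of `γ₀`,
  -- `γ₁`, `β`, only the colour `γ₀` lies in `La i`.
  have hs : Lb (i - 1) = La i → ∀ γ₀ ∈ Lc i, ∀ γ₁ ∈ Lc (i + 1), γ₀ ∈ La i →
      (γ₁ = γ₀ ∨ γ₁ ∉ La i) → ∀ β ∈ Lb i, β ≠ γ₁ → β ∈ La i := by
    intro hF γ₀ h₀ γ₁ h₁ h₀A h₁A β hβ hne
    by_contra hβA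
    refine hns (Solvable.of_split hLa hLb hLc i h₀ h₁ hβ (by rintro rfl; exact hβA h₀A) hne ?_ ?_)
    · rw [hF]
      refine (card_inter_pair_le _ _ _).trans ?_
      simp [hβA, h₀A]
    · rcases h₁A with rfl | h₁A
      · rw [insert_eq_of_mem (by simp)]
        refine (card_inter_pair_le _ _ _).trans ?_
        simp [hβA, h₀A]
      · refine (card_inter_triple_le _ _ _ _).trans ?_
        simp [hβA, h₀A, h₁A]
  by_cases hXY : Disjoint (Lc i) (Lc (i + 1))
  · have hYB := hf.subset_of_disjoint (hLa _) (hLb _) (hLc _) (hLa _) hXY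
    have hXA := hb.subset_of_disjoint (hLb _) (hLa _) (hLc _) (hLb _) hXY.symm
    obtain ⟨γ₀, h₀, h₀B⟩ := exists_mem_notMem_of_disjoint (hLc _) (hLc _) (hLb i) hXY hYB
    obtain ⟨γ₁, h₁, h₁A⟩ := exists_mem_notMem_of_disjoint (hLc _) (hLc _) (hLa i) hXY.symm hXA
    refine ⟨hf.eq_of_disjoint (hLb _) (hLa _) h₀ h₀B h₁ (hYB h₁) h₁A, hXA, ?_⟩
    have hF := hb.eq_of_disjoint (hLa _) (hLb _) h₁ h₁A h₀ (hXA h₀) h₀B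
    refine (card_le_card (t := {γ₁}) fun β hβ => ?_).trans (by simp)
    rw [mem_singleton]
    by_contra hne
    rw [mem_sdiff] at hβ
    exact hβ.2 (hs hF γ₀ h₀ γ₁ h₁ (hXA h₀) (Or.inr h₁A) β hβ.1 hne)
  · obtain ⟨γ, hX, hY⟩ := not_disjoint_iff.1 hXY
    obtain ⟨hγB, hE⟩ := hf.eq_of_mem (hLb _) (hLa _) hX hY
    obtain ⟨hγA, hF⟩ := hb.eq_of_mem (hLa _) (hLb _) hY hX
    refine ⟨hE, fun δ hδ => ?_, ?_⟩
    · by_cases hδγ : γ = δ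
      · rwa [← hδγ]
      · exact (hb.left γ hY (hF ▸ hγA) δ hδ hδγ).2
    · refine (card_le_card (t := {γ}) fun β hβ => ?_).trans (by simp)
      rw [mem_singleton]
      by_contra hne
      rw [mem_sdiff] at hβ
      exact hβ.2 (hs hF γ hX γ hY hγA (Or.inl rfl) β hβ.1 hne)

/-! ### Solving the cycle problem for each length. -/

/-- The colour `s` is used on both `c i` and `a (i + 1)`, and `t` on both `c (i - 1)` and `a i`.
Then `b i` must avoid `s`, `c₁`, `b₁`, the preceding `b`, and `t`; the last costs nothing if `t =
b₁` or `t ∉ Lb i`. Length at least four separates place `i - 2`, where `t` is forbidden, from place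
`i + 1`, where `b₁` may be `t`. -/
theorem Solvable.of_repeat {m : ℕ} {La Lb Lc : ZMod (m + 4) → Finset C}
    (hLa : ∀ i, #(La i) = 5) (hLb : ∀ i, #(Lb i) = 5) (hLc : ∀ i, #(Lc i) = 3) (i : ZMod (m + 4))
    {s t : C} (hs₀ : s ∈ Lc i) (hs₁ : s ∈ La (i + 1)) (ht₀ : t ∈ Lc (i - 1)) (ht₁ : t ∈ La i)
    (hst : s ≠ t) (ht : t ∈ Lb (i + 1) ∨ t ∉ Lb i) : Solvable La Lb Lc := by
  have hk : (m : ZMod (m + 4)) + 4 = 0 := by exact_mod_cast ZMod.natCast_self (m + 4)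
  have e1 : i + 1 + ((m + 1 + 1 : ℕ) : ZMod (m + 4)) = i - 1 := by
    push_cast; linear_combination hk
  have e2 : i + 1 + ((m + 2 + 1 : ℕ) : ZMod (m + 4)) = i := by push_cast; linear_combination hk
  obtain ⟨c₁, hc₁, hc1, hc2⟩ := exists_mem_ne₂ (L := Lc (i + 1)) (hLc _).ge s t
  obtain ⟨b₁, hb₁, hb1, hb2, hb3⟩ :
      ∃ b₁ ∈ Lb (i + 1), b₁ ≠ s ∧ b₁ ≠ c₁ ∧ (b₁ = t ∨ t ∉ Lb i) := by
    rcases ht with ht | ht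
    · exact ⟨t, ht, hst.symm, hc2.symm, Or.inl rfl⟩
    · obtain ⟨b₁, hb₁, hb1, hb2⟩ := exists_mem_ne₂ (L := Lb (i + 1)) (by rw [hLb]; omega) s c₁
      exact ⟨b₁, hb₁, hb1, hb2, Or.inr ht⟩
  refine Solvable.of_states (n := m + 3) (i + 1) (fun j a b c =>
    ((a ∈ La (i + 1 + j) ∧ b ∈ Lb (i + 1 + j) ∧ c ∈ Lc (i + 1 + j)) ∧ Node a b c) ∧
      (j = m + 1 → a ≠ t ∧ b ≠ t) ∧ (j = m + 2 → a ≠ s ∧ a ≠ t ∧ b ≠ s ∧ b ≠ t) ∧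
      (j = m + 3 → Link a b s b₁ c₁)) s b₁ c₁
    ⟨⟨by simpa using ⟨hs₁, hb₁, hc₁⟩, hb1.symm, hc1, hb2.symm⟩, by omega, by omega, by omega⟩
    ?_ (fun j _ a b c h => h.1) (fun a b c h => h.2.2.2 rfl)
  rintro j hj a b c ⟨-, h1, h2, -⟩
  obtain hjm | rfl | rfl | rfl : j < m ∨ j = m ∨ j = m + 1 ∨ j = m + 2 := by omega
  · obtain ⟨a', b', c', h3, h4, h5⟩ := exists_link (La := La (i + 1 + (j + 1 : ℕ)))
      (Lb := Lb (i + 1 + (j + 1 : ℕ))) (by rw [hLa]; omega) (by rw [hLb]; omega)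
      (hLc (i + 1 + (j + 1 : ℕ))).ge a b
    exact ⟨a', b', c', ⟨⟨h3, h4⟩, by omega, by omega, by omega⟩, h5⟩
  · obtain ⟨a', b', c', h3, h4, h5⟩ := exists_link
      (le_card_sdiff_singleton (hLa (i + 1 + (j + 1 : ℕ))).ge t)
      (le_card_sdiff_singleton (hLb (i + 1 + (j + 1 : ℕ))).ge t)
      (hLc (i + 1 + (j + 1 : ℕ))).ge a b
    simp only [mem_sdiff, mem_singleton] at h3
    exact ⟨a', b', c', ⟨⟨⟨h3.1.1, h3.2.1.1, h3.2.2⟩, h4⟩, fun _ => ⟨h3.1.2, h3.2.1.2⟩,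
      by omega, by omega⟩, h5⟩
  -- Place `i - 1`: the outward incidence gets `t`, and `s` is kept off the edge for the sake of `c
  -- i`.
  · obtain ⟨h1a, h1b⟩ := h1 rfl
    obtain ⟨a', ha', h3, h4, h5, h6⟩ := exists_mem_ne₄ (hLa (i - 1)).ge a b s t
    obtain ⟨b', hb', h7, h8, h9, h10⟩ := exists_mem_ne₄ (hLb (i - 1)).ge b s t a'
    refine ⟨a', b', t, ⟨⟨?_, h10.symm, h6.symm, h9.symm⟩, by omega, fun _ => ⟨h5, h6, h8, h9⟩,
      by omega⟩, h1a.symm, h1b.symm, h3, h4, h7⟩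
    rw [e1]
    exact ⟨ha', hb', ht₀⟩
  · obtain ⟨h3, h4, h5, h6⟩ := h2 rfl
    obtain ⟨b₀, hb₀, h7, h8, h9, h10⟩ := exists_mem_ne₄ (hLb i).ge s c₁ b₁ b
    have h11 : b₀ ≠ t := by
      rcases hb3 with rfl | hb3
      · exact h9
      · rintro rfl; exact hb3 hb₀
    refine ⟨t, b₀, s, ⟨⟨?_, h11.symm, hst, h7.symm⟩, by omega, by omega, fun _ =>
      ⟨hc2, h8.symm, hst, h7.symm, h9.symm⟩⟩, h3.symm, h5.symm, h4.symm, h6.symm, h10⟩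
    rw [e2]
    exact ⟨ht₁, hb₀, hs₀⟩

/-- By rigidity `La i` loses at most one colour in passing to `La (i + 1)`, so at least two colours
of `Lc i` survive in `La (i + 1)`. This leaves room for a `t` satisfying the last hypothesis of
`of_repeat` and for an `s ≠ t`. -/
theorem solvable_of_four_le {m : ℕ} {La Lb Lc : ZMod (m + 4) → Finset C}
    (hLa : ∀ i, #(La i) = 5) (hLb : ∀ i, #(Lb i) = 5) (hLc : ∀ i, #(Lc i) = 3) :
    Solvable La Lb Lc := by
  by_contra hns
  have H := lists_of_not_solvable (m := m + 1) hLa hLb hLc hns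
  have hd : ∀ i, #(La i \ La (i + 1)) ≤ 1 := by
    intro i
    rw [(H i).1]
    have h1 := card_sdiff_add_card_inter (La i) (Lb i)
    have h2 := card_sdiff_add_card_inter (Lb i) (La i)
    rw [inter_comm] at h2
    have := (H i).2.2
    rw [hLa] at h1
    rw [hLb] at h2
    omega
  have hc : ∀ i, 2 ≤ #(Lc i ∩ La (i + 1)) := by
    intro i
    have h1 := card_sdiff_add_card_inter (Lc i) (La (i + 1))
    have h2 := card_le_card (sdiff_subset_sdiff (H i).2.1 (subset_refl (La (i + 1))))
    have := hd i
    rw [hLc] at h1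
    omega
  have e : (0 : ZMod (m + 4)) - 1 + 1 = 0 := by ring
  have hc₀ := hc (0 - 1)
  rw [e] at hc₀
  obtain ⟨t, ht, htn⟩ : ∃ t ∈ Lc (0 - 1) ∩ La 0, t ∉ La (0 + 1) \ La (0 + 1 + 1) := by
    by_contra! hsub
    have := card_le_card (show Lc (0 - 1) ∩ La 0 ⊆ La (0 + 1) \ La (0 + 1 + 1) from hsub)
    have := hd (0 + 1)
    omega
  obtain ⟨s, hs, hst⟩ := exists_mem_ne (s := Lc 0 ∩ La (0 + 1)) (hc 0) t
  rw [mem_inter] at ht hs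
  refine hns (Solvable.of_repeat hLa hLb hLc 0 hs.1 hs.2 ht.1 ht.2 hst ?_)
  rw [← (H (0 + 1)).1, ← (H 0).1]
  rw [mem_sdiff] at htn
  tauto

theorem exists_mem_of_triple {Q R : Finset C} (hQ : 4 ≤ #Q) (hR : #R = 3) (p₀ p₁ : C) :
    ∃ p₂ ∈ Q, p₂ ≠ p₀ ∧ p₂ ≠ p₁ ∧ ∃ c ∈ R, c ≠ p₀ ∧ c ≠ p₁ ∧ c ≠ p₂ := by
  obtain ⟨r, hr, hr₀, hr₁⟩ := exists_mem_ne₂ hR.ge p₀ p₁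
  obtain ⟨p₂, hp₂, h₀, h₁, h₂⟩ := exists_mem_ne₃ hQ p₀ p₁ r
  exact ⟨p₂, hp₂, h₀, h₁, r, hr, hr₀, hr₁, h₂.symm⟩

/-- It suffices that `p₀ ∉ R 0`, that `p₀` or `p₁` is outside `R 1`, and that `p₂` avoids some
colour of `R 2` other than `p₀` and `p₁`. -/
theorem exists_distinct_triple {Q R : ZMod 3 → Finset C} (hQ : ∀ i, 4 ≤ #(Q i))
    (hR : ∀ i, #(R i) = 3) : ∃ p : ZMod 3 → C, Function.Injective p ∧ (∀ i, p i ∈ Q i) ∧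
      ∀ i, ∃ c ∈ R i, ∀ j, c ≠ p j := by
  have avoid : ∀ i p₀, p₀ ∉ R i → ∀ p₁ p₂, ∃ c ∈ R i, c ≠ p₀ ∧ c ≠ p₁ ∧ c ≠ p₂ := by
    intro i p₀ hp₀ p₁ p₂
    obtain ⟨c, hc, h₁, h₂⟩ := exists_mem_ne₂ (hR i).ge p₁ p₂
    exact ⟨c, hc, by rintro rfl; exact hp₀ hc, h₁, h₂⟩
  obtain ⟨p₀, hp₀, hp₀R⟩ := exists_mem_notMem_of_card_lt_card (s := R 0) (t := Q 0)
    (by have := hQ 0; rw [hR]; omega)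
  obtain ⟨p₁, hp₁, hne, hor⟩ : ∃ p₁ ∈ Q 1, p₁ ≠ p₀ ∧ (p₁ ∉ R 1 ∨ p₀ ∉ R 1) := by
    by_cases h : p₀ ∈ R 1
    · obtain ⟨p₁, hp₁, hp₁R⟩ := exists_mem_notMem_of_card_lt_card (s := R 1) (t := Q 1)
        (by have := hQ 1; rw [hR]; omega)
      exact ⟨p₁, hp₁, by rintro rfl; exact hp₁R h, Or.inl hp₁R⟩
    · obtain ⟨p₁, hp₁, hne⟩ := exists_mem_ne (s := Q 1) (by have := hQ 1; omega) p₀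
      exact ⟨p₁, hp₁, hne, Or.inr h⟩
  obtain ⟨p₂, hp₂, h₀, h₁, c₂, hc₂, hc₂'⟩ := exists_mem_of_triple (hQ 2) (hR 2) p₀ p₁
  have hfin : ∀ P : ZMod 3 → Prop, P 0 → P 1 → P 2 → ∀ i, P i := by
    intro P h0 h1 h2 i
    fin_cases i
    exacts [h0, h1, h2]
  refine ⟨![p₀, p₁, p₂], ?_, hfin _ hp₀ hp₁ hp₂, hfin _ ?_ ?_ ?_⟩
  · refine fun i j => ?_
    revert j
    revert i
    refine hfin _ (hfin _ ?_ ?_ ?_) (hfin _ ?_ ?_ ?_) (hfin _ ?_ ?_ ?_) <;> intro h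
    · rfl
    · exact absurd h hne.symm
    · exact absurd h h₀.symm
    · exact absurd h hne
    · rfl
    · exact absurd h h₁.symm
    · exact absurd h h₀
    · exact absurd h h₁
    · rfl
  · obtain ⟨c, hc, h⟩ := avoid 0 p₀ hp₀R p₁ p₂
    exact ⟨c, hc, hfin _ h.1 h.2.1 h.2.2⟩
  · rcases hor with hor | hor
    · obtain ⟨c, hc, h⟩ := avoid 1 p₁ hor p₀ p₂
      exact ⟨c, hc, hfin _ h.2.1 h.1 h.2.2⟩
    · obtain ⟨c, hc, h⟩ := avoid 1 p₀ hor p₁ p₂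
      exact ⟨c, hc, hfin _ h.1 h.2.1 h.2.2⟩
  · exact ⟨c₂, hc₂, hfin _ hc₂'.1 hc₂'.2.1 hc₂'.2.2⟩

/-- On a triangle `a i` and `b (i + 1)` may agree, so three colours serve all six cycle incidences.
Rigid lists allow this: `La i` and `La (i - 1)` share at least four colours, and `Lb (i + 1) = La (i
- 1)`. -/
theorem solvable_three {La Lb Lc : ZMod 3 → Finset C}
    (hLa : ∀ i, #(La i) = 5) (hLb : ∀ i, #(Lb i) = 5) (hLc : ∀ i, #(Lc i) = 3) :
    Solvable La Lb Lc := by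
  by_contra hns
  have H := lists_of_not_solvable (m := 0) hLa hLb hLc hns
  have hQ : ∀ i, 4 ≤ #(La i ∩ La (i - 1)) := by
    intro i
    have h := H (i - 1)
    rw [sub_add_cancel] at h
    have h1 := card_sdiff_add_card_inter (La i) (La (i - 1))
    have h2 := h.2.2
    rw [← h.1] at h2
    rw [hLa] at h1
    omega
  obtain ⟨p, hp, hpQ, hpR⟩ := exists_distinct_triple hQ hLc
  choose c hc hcp using hpR
  have hne : ∀ i j, i ≠ j → p i ≠ p j := fun i j h => hp.ne h
  refine hns ⟨p, fun i => p (i - 1), c, fun i => ⟨(mem_inter.1 (hpQ i)).1, ?_, hc i⟩, fun i =>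
    ⟨⟨hne _ _ ?_, hcp _ _, hcp _ _⟩, hcp _ _, hcp _ _, hne _ _ ?_, hne _ _ ?_, hne _ _ ?_⟩⟩
  · rw [← (H i).1]
    have : i + 1 = i - 1 - 1 := by revert i; decide
    rw [this]
    exact (mem_inter.1 (hpQ (i - 1))).2
  all_goals revert i; decide

/-- The incidence `a 0`, coloured last, sees all five others, so `c₀` and `c₁` may take only one
colour from `La 0`. Either they are equal, or one is outside `La 0`: two disjoint triples do not fit
in five colours. -/
theorem solvable_two {La Lb Lc : ZMod 2 → Finset C}
    (hLa : ∀ i, #(La i) = 5) (hLb : ∀ i, #(Lb i) = 5) (hLc : ∀ i, #(Lc i) = 3) :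
    Solvable La Lb Lc := by
  obtain ⟨c₀, c₁, h₀, h₁, hcard⟩ : ∃ c₀ c₁, c₀ ∈ Lc 0 ∧ c₁ ∈ Lc 1 ∧ #(La 0 ∩ {c₀, c₁}) ≤ 1 := by
    by_cases hd : Disjoint (Lc 0) (Lc 1)
    · obtain ⟨x, hx⟩ : (Lc 0).Nonempty := card_pos.1 (by rw [hLc]; omega)
      obtain ⟨y, hy⟩ : (Lc 1).Nonempty := card_pos.1 (by rw [hLc]; omega)
      by_cases hs : Lc 0 ⊆ La 0
      · obtain ⟨γ, hγ, hγn⟩ := exists_mem_notMem_of_disjoint (hLc 1) (hLc 0) (hLa 0) hd.symm hs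
        refine ⟨x, γ, hx, hγ, (card_inter_pair_le _ _ _).trans ?_⟩
        rw [if_neg hγn]; split_ifs <;> simp
      · obtain ⟨γ, hγ, hγn⟩ := not_subset.1 hs
        refine ⟨γ, y, hγ, hy, (card_inter_pair_le _ _ _).trans ?_⟩
        rw [if_neg hγn]; split_ifs <;> simp
    · obtain ⟨γ, hX, hY⟩ := not_disjoint_iff.1 hd
      exact ⟨γ, γ, hX, hY, (card_le_card inter_subset_right).trans (by simp)⟩
  obtain ⟨b₀, hb₀, b1, b2⟩ := exists_mem_ne₂ (L := Lb 0) (by rw [hLb]; omega) c₀ c₁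
  obtain ⟨a₁, ha₁, a1, a2, a3⟩ := exists_mem_ne₃ (L := La 1) (by rw [hLa]; omega) c₀ c₁ b₀
  obtain ⟨b₁, hb₁, b3, b4, b5, b6⟩ := exists_mem_ne₄ (hLb 1).ge c₀ c₁ b₀ a₁
  obtain ⟨a₀, ha₀, a4, a5, a6⟩ :=
    exists_mem_ne₃ (card_sdiff_of_inter (m := 4) (hLa 0) hcard) b₀ a₁ b₁
  simp only [mem_sdiff, mem_insert, mem_singleton, not_or, ← ne_eq] at ha₀
  have hfin : ∀ P : ZMod 2 → Prop, P 0 → P 1 → ∀ i, P i := by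
    intro P h0 h1 i
    fin_cases i
    exacts [h0, h1]
  refine ⟨![a₀, a₁], ![b₀, b₁], ![c₀, c₁], hfin _ ⟨ha₀.1, hb₀, h₀⟩ ⟨ha₁, hb₁, h₁⟩,
    hfin _ ⟨⟨a4, ha₀.2.1.symm, b1.symm⟩, ?_⟩ ⟨⟨b6.symm, a2.symm, b4.symm⟩, ?_⟩⟩
  · exact ⟨ha₀.2.2.symm, b2.symm, a5.symm, a3, b5⟩
  · exact ⟨a1.symm, b3.symm, a5, a6, b5.symm⟩

end IncidenceCycle

namespace IncidenceCycle

theorem solvable_of_card_le {C : Type w} {k : ℕ} (hk : 2 ≤ k) {La Lb Lc : ZMod k → Finset C}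
    (hLa : ∀ i, 5 ≤ #(La i)) (hLb : ∀ i, 5 ≤ #(Lb i)) (hLc : ∀ i, 3 ≤ #(Lc i)) :
    Solvable La Lb Lc := by
  classical
  choose La' hLa' ha using fun i => exists_subset_card_eq (hLa i)
  choose Lb' hLb' hb using fun i => exists_subset_card_eq (hLb i)
  choose Lc' hLc' hc using fun i => exists_subset_card_eq (hLc i)
  refine Solvable.mono ?_ hLa' hLb' hLc'
  match k, hk with
  | 2, _ => exact solvable_two ha hb hc
  | 3, _ => exact solvable_three ha hb hc
  | m + 4, _ => exact solvable_of_four_le ha hb hc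

end IncidenceCycle

/-! ### Half-edges and greedy extension of colourings. -/

/-- A loopless multigraph given by its half-edges: each has a vertex and an opposite. -/
structure HalfEdges (D : Type u) (V : Type v) where
  vert : D → V
  opp : D → D
  opp_opp : ∀ h, opp (opp h) = h
  vert_opp_ne : ∀ h, vert (opp h) ≠ vert h

namespace HalfEdges

variable {D : Type u} {V : Type v} {C : Type w} (H : HalfEdges D V)

/-- Adjacency of half-edges, viewed as incidences. -/
def Adj (h h' : D) : Prop :=
  h ≠ h' ∧ (H.vert h = H.vert h' ∨ H.vert (H.opp h) = H.vert h' ∨ H.vert (H.opp h') = H.vert h)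

variable {H} in
theorem Adj.symm {h h' : D} (hh : H.Adj h h') : H.Adj h' h :=
  ⟨hh.1.symm, by have := hh.2; tauto⟩

theorem opp_injective : Function.Injective H.opp :=
  Function.LeftInverse.injective H.opp_opp

/-- The half-edges in `S` can be properly coloured from the lists `L`. -/
def Colorable (L : D → Finset C) (S : Set D) : Prop :=
  ∃ φ : D → C, (∀ h, φ h ∈ L h) ∧ ∀ h ∈ S, ∀ h' ∈ S, H.Adj h h' → φ h ≠ φ h'

variable {H} {L : D → Finset C} {S S' : Set D}

theorem Colorable.mono (hS : H.Colorable L S) (h : S' ⊆ S) : H.Colorable L S' := by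
  obtain ⟨φ, hφ, hp⟩ := hS
  exact ⟨φ, hφ, fun x hx y hy => hp x (h hx) y (h hy)⟩

theorem Colorable.insert_of_card (hS : H.Colorable L S) {h : D} (N : Finset D)
    (hN : ∀ h' ∈ S, H.Adj h h' → h' ∈ N) (hcard : #N < #(L h)) :
    H.Colorable L (insert h S) := by
  classical
  obtain ⟨φ, hφ, hp⟩ := hS
  obtain ⟨y, hy, hyN⟩ := exists_mem_notMem_of_card_lt_card (card_image_le.trans_lt hcard)
    (s := N.image φ)
  have key : ∀ h' ∈ S, H.Adj h h' → y ≠ φ h' := by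
    rintro h' h'S hadj rfl
    exact hyN (mem_image_of_mem φ (hN h' h'S hadj))
  refine ⟨Function.update φ h y, fun h' => ?_, fun h₁ h₁S h₂ h₂S hadj => ?_⟩
  · by_cases e : h' = h
    · subst e; simpa using hy
    · simpa [e] using hφ h'
  · by_cases e₁ : h₁ = h
    · subst e₁
      have e₂ : h₂ ≠ h₁ := hadj.1.symm
      simpa [e₂] using key h₂ (h₂S.resolve_left e₂) hadj
    · by_cases e₂ : h₂ = h
      · subst e₂
        simpa [e₁] using (key h₁ (h₁S.resolve_left e₁) hadj.symm).symm
      · simpa [e₁, e₂] using hp h₁ (h₁S.resolve_left e₁) h₂ (h₂S.resolve_left e₂) hadj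

/-- `N` bounds all adjacent half-edges, coloured or not, so the order within `T` is irrelevant. -/
theorem Colorable.union_of_card (hS : H.Colorable L S) (T : Finset D)
    (hT : ∀ h ∈ T, ∃ N : Finset D, (∀ h', H.Adj h h' → h' ∈ N) ∧ #N < #(L h)) :
    H.Colorable L (S ∪ T) := by
  classical
  induction T using Finset.induction_on with
  | empty => simpa using hS
  | insert h T _ ih =>
    obtain ⟨N, hN, hcard⟩ := hT h (mem_insert_self _ _)
    rw [coe_insert, Set.union_insert]
    exact (ih fun h' hh' => hT h' (mem_insert_of_mem hh')).insert_of_card N (fun h' _ => hN h') hcard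

variable (H) [Fintype D] [DecidableEq V]

/-- The half-edges at a vertex. -/
def star (x : V) : Finset D := univ.filter fun h => H.vert h = x

variable {H}

@[simp] theorem mem_star {x : V} {h : D} : h ∈ H.star x ↔ H.vert h = x := by simp [star]

theorem Colorable.of_card_star_le_two [DecidableEq D] (hdeg : ∀ x, #(H.star x) ≤ 3)
    (hL : ∀ h, 6 ≤ #(L h))
    {x : V} (hx : #(H.star x) ≤ 2) (hS : H.Colorable L S) :
    H.Colorable L (S ∪ H.star x) := by
  -- At most five neighbours: three at the far end of `h`, one other at `x`, and the opposite of
  -- that one.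
  refine hS.union_of_card _ fun h hh => ⟨H.star (H.vert (H.opp h)) ∪ (H.star x).erase h ∪
    ((H.star x).erase h).image H.opp, fun h' hadj => ?_, ?_⟩
  · rw [mem_star] at hh
    simp only [mem_union, mem_star, mem_erase, mem_image]
    rcases hadj.2 with e | e | e
    · exact Or.inl (Or.inr ⟨hadj.1.symm, by rw [← e, hh]⟩)
    · exact Or.inl (Or.inl e.symm)
    · by_cases e' : H.opp h' = h
      · refine Or.inl (Or.inl ?_)
        rw [← e', H.opp_opp]
      · exact Or.inr ⟨H.opp h', ⟨e', by rw [e, hh]⟩, H.opp_opp _⟩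
  · have h1 := card_union_le (H.star (H.vert (H.opp h)) ∪ (H.star x).erase h)
      (((H.star x).erase h).image H.opp)
    have h2 := card_union_le (H.star (H.vert (H.opp h))) ((H.star x).erase h)
    have h3 := card_image_le (s := (H.star x).erase h) (f := H.opp)
    have h4 := card_erase_of_mem hh
    have h5 := hdeg (H.vert (H.opp h))
    have h6 := hL h
    omega

/-- A cubic vertex with an uncoloured neighbour can be coloured. -/
theorem Colorable.of_outward [DecidableEq D] (hdeg : ∀ x, #(H.star x) ≤ 3)
    (hL : ∀ h, 6 ≤ #(L h)) {x : V} {h₁ h₂ h₃ : D} (hx : H.star x = {h₁, h₂, h₃})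
    (hS : H.Colorable L S) (hSx : ∀ h ∈ S, H.vert h ≠ x)
    (hout : ∀ h ∈ S, H.vert h ≠ H.vert (H.opp h₃)) :
    H.Colorable L (S ∪ H.star x) := by
  have hm : ∀ h, H.vert h = x ↔ h = h₁ ∨ h = h₂ ∨ h = h₃ := by
    intro h; rw [← mem_star, hx]; simp
  have v₁ : H.vert h₁ = x := (hm h₁).2 (by simp)
  have v₂ : H.vert h₂ = x := (hm h₂).2 (by simp)
  have v₃ : H.vert h₃ = x := (hm h₃).2 (by simp)
  have hopp : ∀ h ∈ S, H.vert (H.opp h) = x → h = H.opp h₁ ∨ h = H.opp h₂ := by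
    intro h hh he
    have : ∀ y, H.opp h = y → h = H.opp y := fun y hy => by rw [← hy, H.opp_opp]
    rcases (hm _).1 he with e | e | e
    · exact Or.inl (this _ e)
    · exact Or.inr (this _ e)
    · exact absurd (by rw [this _ e]) (hout h hh)
  have hcard : ∀ h, ∀ T : Finset D, #T ≤ 2 → #(H.star (H.vert (H.opp h)) ∪ T) < #(L h) := by
    intro h T hT
    have := card_union_le (H.star (H.vert (H.opp h))) T
    have := hdeg (H.vert (H.opp h))
    have := hL h
    omega
  -- Nothing is coloured at the far end of `h₃`, so `h₁`, `h₂`, `h₃`, in this order, see at most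
  -- four, five and four coloured half-edges.
  have s₁ : H.Colorable L (insert h₁ S) := by
    refine hS.insert_of_card (H.star (H.vert (H.opp h₁)) ∪ {H.opp h₂}) (fun h hh hadj => ?_)
      (hcard _ _ (by simp))
    simp only [mem_union, mem_star, mem_singleton]
    rcases hadj.2 with e | e | e
    · exact absurd (e.symm.trans v₁) (hSx h hh)
    · exact Or.inl e.symm
    · rcases hopp h hh (e.trans v₁) with rfl | rfl
      · exact Or.inl rfl
      · exact Or.inr rfl
  have s₂ : H.Colorable L (insert h₂ (insert h₁ S)) := by
    refine s₁.insert_of_card (H.star (H.vert (H.opp h₂)) ∪ {H.opp h₁, h₁}) (fun h hh hadj => ?_)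
      (hcard _ _ card_le_two)
    simp only [mem_union, mem_star, mem_singleton, mem_insert]
    rcases hh with rfl | hh
    · simp
    rcases hadj.2 with e | e | e
    · exact absurd (e.symm.trans v₂) (hSx h hh)
    · exact Or.inl e.symm
    · rcases hopp h hh (e.trans v₂) with rfl | rfl
      · simp
      · exact Or.inl rfl
  have s₃ : H.Colorable L (insert h₃ (insert h₂ (insert h₁ S))) := by
    refine s₂.insert_of_card {H.opp h₁, H.opp h₂, h₁, h₂} (fun h hh hadj => ?_)
      (card_le_four.trans_lt (by have := hL h₃; omega))
    simp only [mem_singleton, mem_insert]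
    rcases hh with rfl | rfl | hh
    · simp
    · simp
    rcases hadj.2 with e | e | e
    · exact absurd (e.symm.trans v₃) (hSx h hh)
    · exact absurd e.symm (hout h hh)
    · rcases hopp h hh (e.trans v₃) with rfl | rfl <;> simp
  refine s₃.mono ?_
  rintro h (hh | hh)
  · simp [hh]
  · rw [hx] at hh
    simp only [coe_insert, coe_singleton, Set.mem_insert_iff, Set.mem_singleton_iff] at hh ⊢
    tauto

/-- Three parallel edges can be coloured. -/
theorem Colorable.of_parallel [DecidableEq D] (hdeg : ∀ x, #(H.star x) ≤ 3)
    (hL : ∀ h, 6 ≤ #(L h)) {x y : V} (hx : #(H.star x) = 3)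
    (hxy : ∀ h, H.vert h = x → H.vert (H.opp h) = y) (hS : H.Colorable L S) :
    H.Colorable L (S ∪ (H.star x ∪ H.star y : Finset D)) := by
  have himg : (H.star x).image H.opp = H.star y := by
    refine eq_of_subset_of_card_le ?_ ?_
    · intro h hh
      simp only [mem_image, mem_star] at hh ⊢
      obtain ⟨h', e, rfl⟩ := hh
      exact hxy h' e
    · rw [card_image_of_injective _ H.opp_injective, hx]
      exact hdeg y
  have hyx : ∀ h, H.vert h = y → H.vert (H.opp h) = x := by
    intro h hh
    rw [← mem_star, ← himg, mem_image] at hh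
    obtain ⟨h', e, rfl⟩ := hh
    rwa [H.opp_opp, ← mem_star]
  refine hS.union_of_card _ fun h hh => ⟨(H.star x ∪ H.star y).erase h, fun h' hadj => ?_, ?_⟩
  · simp only [mem_union, mem_star] at hh
    simp only [mem_erase, mem_union, mem_star]
    refine ⟨hadj.1.symm, ?_⟩
    rcases hh with hh | hh
    · rcases hadj.2 with e | e | e
      · exact Or.inl (e.symm.trans hh)
      · exact Or.inr (e.symm.trans (hxy _ hh))
      · have := hxy _ (e.trans hh)
        rw [H.opp_opp] at this
        exact Or.inr this
    · rcases hadj.2 with e | e | e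
      · exact Or.inr (e.symm.trans hh)
      · exact Or.inl (e.symm.trans (hyx _ hh))
      · have := hyx _ (e.trans hh)
        rw [H.opp_opp] at this
        exact Or.inl this
  · have h1 := card_union_le (H.star x) (H.star y)
    have h2 := card_erase_of_mem hh
    have h3 := hdeg y
    have h4 := hL h
    omega

end HalfEdges

/-! ### Shortest closed walks and chordless cycles. -/

namespace HalfEdges

variable {D : Type u} {V : Type v} {C : Type w} {H : HalfEdges D V}

/-- `f 0, …, f n` is a closed walk within `W` which does not turn back, except possibly at its
start. -/
structure IsClosedWalk (H : HalfEdges D V) (W : Set V) (n : ℕ) (f : ℕ → D) : Prop where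
  mem : ∀ j ≤ n, H.vert (f j) ∈ W
  link : ∀ j < n, H.vert (H.opp (f j)) = H.vert (f (j + 1))
  ne : ∀ j < n, f (j + 1) ≠ H.opp (f j)
  close : H.vert (H.opp (f n)) = H.vert (f 0)

theorem exists_isClosedWalk [Finite D] {W : Set V} {h₀ : D} (h₀W : H.vert h₀ ∈ W)
    (hW : ∀ h, H.vert h ∈ W → H.vert (H.opp h) ∈ W)
    (hnext : ∀ h, H.vert h ∈ W → ∃ h', H.vert h' = H.vert h ∧ h' ≠ h) :
    ∃ n f, IsClosedWalk H W n f := by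
  have hstep : ∀ h, H.vert h ∈ W → ∃ h', H.vert (H.opp h) = H.vert h' ∧ h' ≠ H.opp h := by
    intro h hh
    obtain ⟨h', e, hne⟩ := hnext _ (hW h hh)
    exact ⟨h', e.symm, hne⟩
  choose! g hg hgne using hstep
  have hmem : ∀ j, H.vert (g^[j] h₀) ∈ W := by
    intro j
    induction j with
    | zero => exact h₀W
    | succ j ih =>
      rw [Function.iterate_succ_apply', ← hg _ ih]
      exact hW _ ih
  have hlt : ∃ i j, i < j ∧ g^[i] h₀ = g^[j] h₀ := by
    obtain ⟨i, j, hne, e⟩ := Finite.exists_ne_map_eq_of_infinite fun j => g^[j] h₀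
    rcases hne.lt_or_gt with h | h
    exacts [⟨i, j, h, e⟩, ⟨j, i, h, e.symm⟩]
  obtain ⟨i, j, hij, e⟩ := hlt
  obtain ⟨n, rfl⟩ := Nat.exists_eq_add_of_lt hij
  refine ⟨n, fun t => g^[i + t] h₀, fun t _ => hmem _, fun t _ => ?_, fun t _ => ?_, ?_⟩
  · rw [← add_assoc, Function.iterate_succ_apply']
    exact hg _ (hmem _)
  · rw [← add_assoc, Function.iterate_succ_apply']
    exact hgne _ (hmem _)
  · rw [Function.iterate_succ_apply'] at e
    rw [hg _ (hmem _), ← e, add_zero]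

variable {W : Set V} {n : ℕ} {f : ℕ → D}

theorem IsClosedWalk.drop_ends (hf : IsClosedWalk H W (n + 2) f) (h : f 0 = H.opp (f (n + 2))) :
    IsClosedWalk H W n fun t => f (t + 1) where
  mem j hj := hf.mem _ (by omega)
  link j hj := hf.link _ (by omega)
  ne j hj := hf.ne _ (by omega)
  close := by
    rw [hf.link _ (by omega), zero_add, ← hf.link 0 (by omega), h, H.opp_opp]

theorem IsClosedWalk.segment (hf : IsClosedWalk H W n f) {i m : ℕ} (him : i + m + 1 ≤ n)
    (h : H.vert (f i) = H.vert (f (i + m + 1))) : IsClosedWalk H W m fun t => f (i + t) where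
  mem j hj := hf.mem _ (by omega)
  link j hj := hf.link _ (by omega)
  ne j hj := hf.ne (i + j) (by omega)
  close := by rw [hf.link _ (by omega), add_zero, h]

/-- A segment of a walk closed up by a further half-edge. -/
theorem IsClosedWalk.segment_chord (hf : IsClosedWalk H W n f) {i m : ℕ} (him : i + m + 1 ≤ n)
    {c : D} (hi : H.vert c = H.vert (f i)) (hj : H.vert (H.opp c) = H.vert (f (i + m + 1)))
    (hc : ∀ l ≤ n, c ≠ f l) :
    IsClosedWalk H W (m + 1) fun t => if t = m + 1 then H.opp c else f (i + t) where
  mem j hj' := by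
    split_ifs with h
    · rw [hj]; exact hf.mem _ him
    · exact hf.mem _ (by omega)
  link j hj' := by
    rw [if_neg (by omega)]
    split_ifs with h
    · obtain rfl : j = m := by omega
      rw [hj, hf.link _ (by omega)]
    · exact hf.link _ (by omega)
  ne j hj' := by
    rw [if_neg (show ¬ j = m + 1 by omega)]
    split_ifs with h
    · exact fun e => hc (i + j) (by omega) (H.opp_injective e)
    · exact hf.ne (i + j) (by omega)
  close := by
    rw [if_pos rfl, if_neg (by omega), H.opp_opp, hi, add_zero]

theorem IsClosedWalk.pair_chord (hf : IsClosedWalk H W n f) {c : D}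
    (hi : H.vert c = H.vert (f 0)) (hj : H.vert (H.opp c) = H.vert (f n))
    (hc : ∀ l ≤ n, c ≠ H.opp (f l)) :
    IsClosedWalk H W 1 fun t => if t = 0 then c else f n where
  mem j hj' := by
    split_ifs with h
    · rw [hi]; exact hf.mem _ (by omega)
    · exact hf.mem _ le_rfl
  link j hj' := by
    obtain rfl : j = 0 := by omega
    simpa using hj
  ne j hj' := by
    obtain rfl : j = 0 := by omega
    simp only [zero_add, one_ne_zero, if_true, if_false]
    intro e
    exact hc n le_rfl (by rw [e, H.opp_opp])
  close := by simpa [hi] using hf.close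

/-- A cycle, as a cyclic sequence of half-edges. -/
structure IsCycle (H : HalfEdges D V) {k : ℕ} (h : ZMod k → D) : Prop where
  link : ∀ i, H.vert (H.opp (h i)) = H.vert (h (i + 1))
  ne : ∀ i, h (i + 1) ≠ H.opp (h i)
  inj : ∀ i j, H.vert (h i) = H.vert (h j) → i = j

/-- Take a closed walk with `n` least (it has `n + 1` half-edges). A repeated vertex or a turn at
the start would shorten it. A chord cuts off a shorter walk unless it joins the vertices of `f 0`
and `f n`; then it is parallel to the closing edge and gives a digon. For `k = 2` a third parallel
edge remains possible, hence the proviso. -/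
theorem exists_isCycle (hex : ∃ n f, IsClosedWalk H W n f) :
    ∃ (k : ℕ) (h : ZMod k → D), 2 ≤ k ∧ IsCycle H h ∧ (∀ i, H.vert (h i) ∈ W) ∧
      (2 < k → ∀ c, (∀ l, c ≠ h l ∧ c ≠ H.opp (h l)) → ∀ i j, H.vert c = H.vert (h i) →
        H.vert (H.opp c) ≠ H.vert (h j)) := by
  classical
  obtain ⟨f, hf⟩ := Nat.find_spec hex
  have hmin : ∀ m g, IsClosedWalk H W m g → Nat.find hex ≤ m :=
    fun m g hg => Nat.find_min' hex ⟨g, hg⟩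
  generalize Nat.find hex = n at hf hmin
  have hn : 1 ≤ n := by
    by_contra h
    obtain rfl : n = 0 := by omega
    exact H.vert_opp_ne _ hf.close
  have hinj : ∀ i j, i < j → j ≤ n → H.vert (f i) ≠ H.vert (f j) := by
    intro i j hij hj e
    obtain ⟨m, rfl⟩ := Nat.exists_eq_add_of_lt hij
    have := hmin _ _ (hf.segment hj e)
    omega
  have hturn : f 0 ≠ H.opp (f n) := by
    intro e
    obtain rfl | hn2 : n = 1 ∨ 2 ≤ n := by omega
    · exact hf.ne 0 one_pos (by rw [e, H.opp_opp])
    · obtain ⟨m, rfl⟩ := Nat.exists_eq_add_of_le' hn2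
      have := hmin _ _ (hf.drop_ends e)
      omega
  have hchord : 1 < n → ∀ c, (∀ l ≤ n, c ≠ f l ∧ c ≠ H.opp (f l)) → ∀ i j, i < j → j ≤ n →
      H.vert c = H.vert (f i) → H.vert (H.opp c) ≠ H.vert (f j) := by
    intro hn1 c hc i j hij hj hi e
    obtain ⟨m, rfl⟩ := Nat.exists_eq_add_of_lt hij
    have h1 := hmin _ _ (hf.segment_chord hj hi e fun l hl => (hc l hl).1)
    obtain rfl : i = 0 := by omega
    obtain rfl : n = 0 + m + 1 := by omega
    have h2 := hmin _ _ (hf.pair_chord hi e fun l hl => (hc l hl).2)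
    omega
  have hval : ∀ i : ZMod (n + 1), i.val ≤ n := fun i => Nat.lt_succ_iff.1 (ZMod.val_lt i)
  have hsucc : ∀ i : ZMod (n + 1), (i.val < n ∧ (i + 1).val = i.val + 1) ∨
      (i.val = n ∧ (i + 1).val = 0) := by
    intro i
    rcases (hval i).lt_or_eq with h | h
    · left
      have := ZMod.val_cast_of_lt (n := n + 1) (a := i.val + 1) (by omega)
      rw [Nat.cast_succ, ZMod.natCast_zmod_val] at this
      exact ⟨h, this⟩
    · right
      have h0 : i + 1 = 0 := by
        rw [← ZMod.natCast_zmod_val i, h]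
        exact_mod_cast ZMod.natCast_self (n + 1)
      rw [h0, ZMod.val_zero]
      exact ⟨h, rfl⟩
  refine ⟨n + 1, fun i => f i.val, by omega, ⟨fun i => ?_, fun i => ?_, fun i j e => ?_⟩,
    fun i => hf.mem _ (hval i), fun hn2 c hc i j hi hj => ?_⟩
  · rcases hsucc i with ⟨h, e⟩ | ⟨h, e⟩
    · simp only [e]; exact hf.link _ h
    · simp only [e, h]; exact hf.close
  · rcases hsucc i with ⟨h, e⟩ | ⟨h, e⟩
    · simp only [e]; exact hf.ne _ h
    · simp only [e, h]; exact hturn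
  · apply ZMod.val_injective
    rcases lt_trichotomy i.val j.val with h | h | h
    · exact absurd e (hinj _ _ h (hval j))
    · exact h
    · exact absurd e.symm (hinj _ _ h (hval i))
  · simp only at hc hi hj
    have hc' : ∀ l ≤ n, c ≠ f l ∧ c ≠ H.opp (f l) := by
      intro l hl
      have := hc (l : ZMod (n + 1))
      rwa [ZMod.val_cast_of_lt (by omega)] at this
    rcases lt_trichotomy i.val j.val with h | h | h
    · exact hchord (by omega) c hc' _ _ h (hval j) hi hj
    · rw [← h, ← hi] at hj
      exact H.vert_opp_ne _ hj
    · refine hchord (by omega) (H.opp c) (fun l hl => ⟨fun e => ?_, fun e => ?_⟩) _ _ h (hval i)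
        hj ?_
      · exact (hc' l hl).2 (by rw [← e, H.opp_opp])
      · exact (hc' l hl).1 (H.opp_injective e)
      · rw [H.opp_opp, hi]

end HalfEdges

/-! ### Extension over a cycle, and the induction on vertex sets. -/

namespace HalfEdges

variable {D : Type u} {V : Type v} {C : Type w} {H : HalfEdges D V} {L : D → Finset C}

open IncidenceCycle in
/-- A colouring off a chordless cycle extends to the cycle. -/
theorem Colorable.of_isCycle [Fintype D] [DecidableEq V] [DecidableEq D]
    (hdeg : ∀ x, #(H.star x) ≤ 3) (hL : ∀ h, 6 ≤ #(L h)) {k : ℕ} (hk : 2 ≤ k) {h : ZMod k → D}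
    (hh : IsCycle H h) (c : ZMod k → D)
    (hstar : ∀ i, H.star (H.vert (h i)) = {h i, H.opp (h (i - 1)), c i})
    (hc₁ : ∀ i, c i ≠ h i) (hc₂ : ∀ i, c i ≠ H.opp (h (i - 1)))
    (hchord : ∀ i j, H.vert (H.opp (c i)) ≠ H.vert (h j)) {S : Set D} (hS : H.Colorable L S)
    (hSh : ∀ x ∈ S, ∀ i, H.vert x ≠ H.vert (h i)) :
    H.Colorable L (S ∪ {x | ∃ i, H.vert x = H.vert (h i)}) := by
  classical
  obtain ⟨φ, hφ, hp⟩ := hS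
  have hm : ∀ x i, H.vert x = H.vert (h i) ↔ x = h i ∨ x = H.opp (h (i - 1)) ∨ x = c i := by
    intro x i
    rw [← mem_star, hstar]; simp
  have hcard : ∀ (x : D) (N : Finset D) (m r : ℕ), #N ≤ r → m + r = 6 →
      m ≤ #(L x \ N.image φ) := by
    intro x N m r hN hmr
    have h1 := le_card_sdiff (N.image φ) (L x)
    have h2 := card_image_le (s := N) (f := φ)
    have h3 := hL x
    omega
  -- The only coloured half-edge adjacent to `h i` is `H.opp (c i)`, and to `H.opp (h i)` it is
  -- `H.opp (c (i + 1))`; `c i` sees at most the three at its outer end.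
  obtain ⟨fa, fb, fc, hmem, hcon⟩ := solvable_of_card_le (k := k) hk
    (La := fun i => L (h i) \ ({H.opp (c i)} : Finset D).image φ)
    (Lb := fun i => L (H.opp (h i)) \ ({H.opp (c (i + 1))} : Finset D).image φ)
    (Lc := fun i => L (c i) \ (H.star (H.vert (H.opp (c i)))).image φ)
    (fun i => hcard _ _ 5 1 (by simp) rfl) (fun i => hcard _ _ 5 1 (by simp) rfl)
    (fun i => hcard _ _ 3 3 (hdeg _) rfl)
  simp only [mem_sdiff, image_singleton, mem_singleton] at hmem
  let ψ : D → C := fun x => if hx : ∃ i, H.vert x = H.vert (h i) then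
    (if x = h hx.choose then fa hx.choose else
      if x = H.opp (h (hx.choose - 1)) then fb (hx.choose - 1) else fc hx.choose) else φ x
  have hψ : ∀ x i, H.vert x = H.vert (h i) → ψ x = if x = h i then fa i else
      if x = H.opp (h (i - 1)) then fb (i - 1) else fc i := by
    intro x i hx
    have hex : ∃ i, H.vert x = H.vert (h i) := ⟨i, hx⟩
    have hi : hex.choose = i := hh.inj _ _ (hex.choose_spec.symm.trans hx)
    simp only [ψ, dif_pos hex, hi]
  have hψ₀ : ∀ x, (∀ i, H.vert x ≠ H.vert (h i)) → ψ x = φ x := by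
    intro x hx
    have hex : ¬ ∃ i, H.vert x = H.vert (h i) := fun ⟨i, hi⟩ => hx i hi
    simp only [ψ, dif_neg hex]
  have hψa : ∀ i, ψ (h i) = fa i := fun i => by rw [hψ _ i rfl, if_pos rfl]
  have hba : ∀ i, H.opp (h (i - 1)) ≠ h i := fun i => by
    have := hh.ne (i - 1)
    rw [sub_add_cancel] at this
    exact this.symm
  have hψb : ∀ i, ψ (H.opp (h (i - 1))) = fb (i - 1) := fun i => by
    rw [hψ _ i ((hm _ i).2 (by simp)), if_neg (hba i), if_pos rfl]
  have hψc : ∀ i, ψ (c i) = fc i := fun i => by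
    rw [hψ _ i ((hm _ i).2 (by simp)), if_neg (hc₁ i), if_neg (hc₂ i)]
  have hψmem : ∀ x, ψ x ∈ L x := by
    intro x
    by_cases hx : ∃ i, H.vert x = H.vert (h i)
    · obtain ⟨i, hi⟩ := hx
      rcases (hm x i).1 hi with rfl | rfl | rfl
      · rw [hψa]; exact (hmem i).1.1
      · rw [hψb]; exact (hmem (i - 1)).2.1.1
      · rw [hψc]; exact (hmem i).2.2.1
    · rw [hψ₀ x fun i hi => hx ⟨i, hi⟩]; exact hφ x
  have hcon' : ∀ i, Node (fa (i - 1)) (fb (i - 1)) (fc (i - 1)) ∧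
      Link (fa (i - 1)) (fb (i - 1)) (fa i) (fb i) (fc i) := fun i => by
    have := hcon (i - 1)
    rwa [sub_add_cancel] at this
  have hvb : ∀ i, H.vert (H.opp (H.opp (h (i - 1)))) = H.vert (h (i - 1)) := fun i => by
    rw [H.opp_opp]
  have hon : ∀ x y, x ≠ y → (∃ i, H.vert x = H.vert (h i)) → (∃ j, H.vert y = H.vert (h j)) →
      (H.vert x = H.vert y ∨ H.vert (H.opp x) = H.vert y) → ψ x ≠ ψ y := by
    rintro x y hne ⟨i, hi⟩ ⟨j, hj⟩ (e | e)
    · have hy := (hm y i).1 (e.symm.trans hi)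
      obtain ⟨⟨n1, n2, n3⟩, -⟩ := hcon i
      obtain ⟨-, l1, l2, l3, l4, l5⟩ := hcon' i
      rcases (hm x i).1 hi with rfl | rfl | rfl <;> rcases hy with rfl | rfl | rfl <;>
        simp only [hψa, hψb, hψc] <;>
        first | exact absurd rfl hne | assumption | (symm; assumption)
    · rcases (hm x i).1 hi with rfl | rfl | rfl
      · rw [hh.link] at e
        have hy := (hm y _).1 e.symm
        rw [add_sub_cancel_right] at hy
        obtain ⟨⟨n1, n2, n3⟩, l1, l2, l3, l4, l5⟩ := hcon i
        have hψb' := hψb (i + 1)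
        rw [add_sub_cancel_right] at hψb'
        rcases hy with rfl | rfl | rfl <;> simp only [hψa, hψb', hψc] <;>
          first | assumption | (symm; assumption)
      · rw [hvb] at e
        obtain ⟨⟨n1, n2, n3⟩, -⟩ := hcon' i
        obtain ⟨-, l1, l2, l3, l4, l5⟩ := hcon' (i - 1)
        rcases (hm y _).1 e.symm with rfl | rfl | rfl <;> simp only [hψa, hψb, hψc] <;>
          first | assumption | (symm; assumption)
      · exact absurd (e.trans hj) (hchord i j)
  have hoff : ∀ x y, (∃ i, H.vert x = H.vert (h i)) → y ∈ S → H.Adj x y → ψ x ≠ ψ y := by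
    rintro x y ⟨i, hi⟩ hy hadj
    rw [hψ₀ y (hSh y hy)]
    have hyo : H.vert (H.opp y) = H.vert (h i) → y = H.opp (c i) := by
      intro e
      have ho : ∀ z, H.opp y = z → y = H.opp z := fun z hz => by rw [← hz, H.opp_opp]
      rcases (hm _ _).1 e with e | e | e
      · exact absurd (by rw [ho _ e, hh.link]) (hSh y hy (i + 1))
      · exact absurd (by rw [ho _ e, H.opp_opp]) (hSh y hy (i - 1))
      · exact ho _ e
    have e := hadj.2
    rw [hi] at e
    have e₁ := e.resolve_left (hSh y hy i).symm
    rcases (hm x i).1 hi with rfl | rfl | rfl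
    · rw [hh.link] at e₁
      rw [hψa, hyo (e₁.resolve_left (hSh y hy _).symm)]
      exact (hmem i).1.2
    · rw [hvb] at e₁
      rw [hψb, hyo (e₁.resolve_left (hSh y hy _).symm)]
      have := (hmem (i - 1)).2.1.2
      rwa [sub_add_cancel] at this
    · rw [hψc]
      intro e₂
      refine (hmem i).2.2.2 (e₂ ▸ mem_image_of_mem φ ?_)
      rw [mem_star]
      rcases e₁ with e₁ | e₁
      · exact e₁.symm
      · rw [hyo e₁]
  refine ⟨ψ, hψmem, ?_⟩
  rintro x (hx | hx) y (hy | hy) hadj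
  · rw [hψ₀ x (hSh x hx), hψ₀ y (hSh y hy)]
    exact hp x hx y hy hadj
  · exact (hoff y x hy hx hadj.symm).symm
  · exact hoff x y hx hy hadj
  · rcases hadj.2 with e | e | e
    · exact hon x y hadj.1 hx hy (Or.inl e)
    · exact hon x y hadj.1 hx hy (Or.inr e)
    · exact (hon y x hadj.1.symm hy hx (Or.inr e)).symm

theorem colorable_of_finset [Fintype D] [DecidableEq V] [DecidableEq D]
    (hdeg : ∀ x, #(H.star x) ≤ 3) (hL : ∀ h, 6 ≤ #(L h)) (W : Finset V) :
    H.Colorable L {h | H.vert h ∈ W} := by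
  induction W using Finset.strongInduction with
  | H W ih =>
  have hstep : ∀ (T : Finset V) (R : Set D), T.Nonempty → T ⊆ W →
      (∀ h, H.vert h ∈ T → h ∈ R) →
      (H.Colorable L {h | H.vert h ∈ W \ T} → H.Colorable L ({h | H.vert h ∈ W \ T} ∪ R)) →
      H.Colorable L {h | H.vert h ∈ W} := by
    intro T R hT hTW hTR hext
    refine (hext (ih _ (sdiff_ssubset hTW hT))).mono fun h hh => ?_
    by_cases hhT : H.vert h ∈ T
    · exact Or.inr (hTR h hhT)
    · exact Or.inl (mem_sdiff.2 ⟨hh, hhT⟩)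
  by_cases h2 : ∃ x ∈ W, #(H.star x) ≤ 2
  · obtain ⟨x, hx, hx2⟩ := h2
    exact hstep {x} (H.star x) (by simp) (by simpa) (by simp)
      (Colorable.of_card_star_le_two hdeg hL hx2)
  push Not at h2
  have h3 : ∀ x ∈ W, #(H.star x) = 3 := fun x hx => le_antisymm (hdeg x) (h2 x hx)
  by_cases hout : ∃ h, H.vert h ∈ W ∧ H.vert (H.opp h) ∉ W
  · obtain ⟨h, hh, ho⟩ := hout
    obtain ⟨h₁, h₂, -, e⟩ := card_eq_two.1
      (show #((H.star (H.vert h)).erase h) = 2 by rw [card_erase_of_mem (by simp), h3 _ hh])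
    have e' : H.star (H.vert h) = {h₁, h₂, h} := by
      rw [← insert_erase (show h ∈ H.star (H.vert h) by simp), e]
      ext; simp; tauto
    refine hstep {H.vert h} (H.star (H.vert h)) (by simp) (by simpa) (by simp)
      fun hS => hS.of_outward hdeg hL e' (fun y hy => ?_) (fun y hy ey => ?_)
    · have : H.vert y ∈ W \ {H.vert h} := hy
      simpa using (mem_sdiff.1 this).2
    · have : H.vert y ∈ W \ {H.vert h} := hy
      exact ho (ey ▸ (mem_sdiff.1 this).1)
  push Not at hout
  by_cases hpar : ∃ x ∈ W, ∃ y, ∀ h, H.vert h = x → H.vert (H.opp h) = y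
  · obtain ⟨x, hx, y, hxy⟩ := hpar
    have hy : y ∈ W := by
      obtain ⟨h, hh⟩ : (H.star x).Nonempty := card_pos.1 (by rw [h3 x hx]; omega)
      rw [mem_star] at hh
      rw [← hxy h hh]
      exact hout h (hh ▸ hx)
    refine hstep {x, y} (H.star x ∪ H.star y : Finset D) (by simp) ?_ (by simp)
      (Colorable.of_parallel hdeg hL (h3 x hx) hxy)
    intro z; simp only [mem_insert, mem_singleton]; rintro (rfl | rfl) <;> assumption
  push Not at hpar
  rcases W.eq_empty_or_nonempty with rfl | ⟨x, hx⟩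
  · obtain ⟨φ, hφ⟩ : ∃ φ : D → C, ∀ h, φ h ∈ L h :=
      Classical.skolem.1 fun h => card_pos.1 (by have := hL h; omega)
    exact ⟨φ, hφ, fun h hh => absurd hh (by simp)⟩
  obtain ⟨h₀, hh₀⟩ : (H.star x).Nonempty := card_pos.1 (by rw [h3 x hx]; omega)
  rw [mem_star] at hh₀
  obtain ⟨k, h, hk, hcyc, hhW, hchord⟩ := exists_isCycle (H := H) (W := W)
    (exists_isClosedWalk (h₀ := h₀) (by rw [hh₀]; exact hx) hout fun h hh => by
      obtain ⟨h', hh', hne⟩ := exists_mem_ne (s := H.star (H.vert h)) (by rw [h3 _ hh]; omega) h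
      exact ⟨h', by simpa using hh', hne⟩)
  have hthird : ∀ i, ∃ c, H.star (H.vert (h i)) = {h i, H.opp (h (i - 1)), c} ∧ c ≠ h i ∧
      c ≠ H.opp (h (i - 1)) := by
    intro i
    have hne := hcyc.ne (i - 1)
    have hv := hcyc.link (i - 1)
    rw [sub_add_cancel] at hne hv
    obtain ⟨c, hc⟩ := card_eq_one.1 (show #(((H.star (H.vert (h i))).erase (h i)).erase
      (H.opp (h (i - 1)))) = 1 by
        rw [card_erase_of_mem (by simp [hv, hne.symm]), card_erase_of_mem (by simp), h3 _ (hhW i)])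
    have hc' : c ∈ ((H.star (H.vert (h i))).erase (h i)).erase (H.opp (h (i - 1))) := by simp [hc]
    refine ⟨c, ?_, by simp only [mem_erase] at hc'; tauto, by simp only [mem_erase] at hc'; tauto⟩
    rw [← hc, insert_erase (by simp [hv, hne.symm]), insert_erase (by simp)]
  choose c hstar hc₁ hc₂ using hthird
  have hvc : ∀ i, H.vert (c i) = H.vert (h i) := fun i => by
    rw [← mem_star, hstar]; simp
  have hnochord : ∀ i j, H.vert (H.opp (c i)) ≠ H.vert (h j) := by
    intro i j
    rcases hk.lt_or_eq with hk | rfl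
    · refine hchord hk (c i) (fun l => ⟨fun e => ?_, fun e => ?_⟩) i j (hvc i)
      · have := hcyc.inj i l (by rw [← hvc, e])
        exact hc₁ i (this ▸ e)
      · have := hcyc.inj i (l + 1) (by rw [← hvc, e, hcyc.link])
        refine hc₂ i ?_
        rw [this, add_sub_cancel_right, ← this, e]
    -- On a digon such a chord would be a third parallel edge, excluded by `hpar`.
    · intro e
      have e2 : ∀ i j : ZMod 2, i ≠ j → j = i + 1 := by decide
      have e3 : ∀ i : ZMod 2, i - 1 = i + 1 := by decide
      have hij : i ≠ j := by
        rintro rfl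
        exact H.vert_opp_ne (c i) (by rw [e, hvc])
      obtain ⟨y, hy, hne⟩ := hpar (H.vert (h i)) (hhW i) (H.vert (h (i + 1)))
      rw [← mem_star, hstar] at hy
      simp only [mem_insert, mem_singleton] at hy
      rcases hy with rfl | rfl | rfl
      · exact hne (hcyc.link i)
      · exact hne (by rw [H.opp_opp, e3])
      · exact hne (by rw [e, e2 i j hij])
  have hfin : NeZero k := ⟨by omega⟩
  refine hstep (univ.image fun i => H.vert (h i)) {x | ∃ i, H.vert x = H.vert (h i)}
    ⟨_, mem_image_of_mem _ (mem_univ 0)⟩ ?_ ?_ fun hS => hS.of_isCycle hdeg hL hk hcyc c hstar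
      hc₁ hc₂ hnochord fun y hy i e => ?_
  · intro z hz
    obtain ⟨i, -, rfl⟩ := mem_image.1 hz
    exact hhW i
  · intro y hy
    obtain ⟨i, -, e⟩ := mem_image.1 hy
    exact ⟨i, e.symm⟩
  · have hy' : H.vert y ∈ W \ univ.image fun i => H.vert (h i) := hy
    exact (mem_sdiff.1 hy').2 (mem_image.2 ⟨i, mem_univ _, e.symm⟩)

end HalfEdges

end

/-! ### Transfer to multigraphs, and the triple edge. -/

namespace Graph

variable {α : Type u} {β : Type v} {G : Graph α β}

/-- The incidences of a loopless multigraph as half-edges. -/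
noncomputable def halfEdges (G : Graph α β) (hG : G.Loopless) : HalfEdges G.Incidence α where
  vert i := i.1.1
  opp i := ⟨(i.2.other, i.1.2), i.2.inc_other⟩
  opp_opp i := Subtype.ext (Prod.ext
    (i.2.inc_other.isLink_other.right_unique i.2.isLink_other.symm) rfl)
  vert_opp_ne i := i.2.isLink_other.ne.symm

theorem isLink_halfEdges_opp (hG : G.Loopless) (i : G.Incidence) :
    G.IsLink i.1.2 i.1.1 ((G.halfEdges hG).vert ((G.halfEdges hG).opp i)) :=
  i.2.isLink_other

theorem IncidenceAdj.halfEdges_adj (hG : G.Loopless) {i j : G.Incidence}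
    (h : G.IncidenceAdj i j) : (G.halfEdges hG).Adj i j := by
  refine ⟨h.1, ?_⟩
  have hi := isLink_halfEdges_opp hG i
  have hj := isLink_halfEdges_opp hG j
  rcases h.2 with e | e | e | e
  · exact Or.inl e
  · refine Or.inr (Or.inl ?_)
    have h' := j.2
    rw [← e] at h'
    refine (h'.eq_of_isLink_of_ne_left hi fun e' => ?_).symm
    exact h.1 (Subtype.ext (Prod.ext e'.symm e))
  · exact Or.inr (Or.inl (hi.right_unique e))
  · exact Or.inr (Or.inr (hj.right_unique e.symm))

theorem incidenceChoosable_six (hV : G.vertexSet.Finite) (hG : G.Loopless) (hG3 : G.IsSubcubic) :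
    IncidenceChoosable.{w} G 6 := by
  classical
  have hinc : ∀ x, {e | G.Inc e x}.encard ≤ 3 := by
    intro x
    by_cases hx : x ∈ G.vertexSet
    · exact le_self_add.trans (hG3 x hx)
    · have : {e | G.Inc e x} = ∅ := by
        ext e
        simpa using fun h : G.Inc e x => hx h.vertex_mem
      simp [this]
  have hfinx : ∀ x, {e | G.Inc e x}.Finite := fun x =>
    Set.finite_of_encard_le_coe (k := 3) (hinc x)
  have hfin : Finite G.Incidence := by
    refine Set.Finite.subset (hV.biUnion fun x _ => (hfinx x).image fun e => (x, e)) ?_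
    rintro ⟨x, e⟩ h
    simp only [Set.mem_iUnion, Set.mem_image]
    exact ⟨x, Graph.Inc.vertex_mem h, e, h, rfl⟩
  have := Fintype.ofFinite G.Incidence
  intro C L hL
  have hdeg : ∀ x, ((G.halfEdges hG).star x).card ≤ 3 := by
    intro x
    have h1 := hinc x
    rw [(hfinx x).encard_eq_coe_toFinset_card] at h1
    refine le_trans (Finset.card_le_card_of_injOn (t := (hfinx x).toFinset) (fun i => i.1.2) ?_ ?_)
      (by exact_mod_cast h1)
    · intro i hi
      have hi' : i.1.1 = x := HalfEdges.mem_star.1 hi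
      simpa [← hi'] using i.2
    · intro i hi j hj e
      have hi' : i.1.1 = x := HalfEdges.mem_star.1 hi
      have hj' : j.1.1 = x := HalfEdges.mem_star.1 hj
      exact Subtype.ext (Prod.ext (hi'.trans hj'.symm) e)
  obtain ⟨φ, hφ, hp⟩ := HalfEdges.colorable_of_finset hdeg (fun i => (hL i).ge)
    (Finset.univ.image (G.halfEdges hG).vert)
  exact ⟨φ, fun i j hij => hp i (by simp) j (by simp) (hij.halfEdges_adj hG), hφ⟩

theorem incidenceChoiceNumber_le {k : ℕ} (h : IncidenceChoosable.{w} G k) :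
    incidenceChoiceNumber.{w} G ≤ k :=
  iInf₂_le k h

theorem tripleEdge_loopless : tripleEdge.Loopless :=
  ⟨fun _ _ h => h rfl⟩

theorem tripleEdge_isSubcubic : tripleEdge.IsSubcubic := by
  intro x _
  have h : {e | tripleEdge.IsLoopAt e x} = ∅ := by
    ext e
    simp only [Set.mem_ofPred_eq, Set.mem_empty_iff_false, iff_false]
    exact fun h => h rfl
  rw [multiDegree, h, Set.encard_empty, add_zero]
  refine (Set.encard_le_encard (Set.subset_univ _)).trans ?_
  simp [Set.encard_univ]

/-- All six incidences are pairwise adjacent, so identical lists of `k` colours already require `k ≥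
6`; `ULift` only adjusts the universe. -/
theorem six_le_of_incidenceChoosable_tripleEdge {k : ℕ}
    (h : IncidenceChoosable.{w} tripleEdge k) : 6 ≤ k := by
  obtain ⟨φ, hφ, -⟩ := h (ULift (Fin k)) (fun _ => Finset.univ) (by simp)
  have hinc : ∀ p : Fin 2 × Fin 3, tripleEdge.Inc p.2 p.1 := fun p =>
    ⟨p.1 + 1, show p.1 ≠ p.1 + 1 by revert p; decide⟩
  have hinj : Function.Injective fun p : Fin 2 × Fin 3 => φ ⟨p, hinc p⟩ := by
    intro p q e
    by_contra hne
    refine hφ ⟨p, hinc p⟩ ⟨q, hinc q⟩ ⟨fun e => hne (congrArg Subtype.val e), ?_⟩ e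
    by_cases hpq : p.1 = q.1
    · exact Or.inl hpq
    · exact Or.inr (Or.inr (Or.inl hpq))
  simpa using Fintype.card_le_of_injective _ hinj

end Graph

theorem theorem1p3 :
    (∀ {α : Type u} {β : Type v} (G : Graph α β), G.vertexSet.Finite → G.Loopless →
      G.IsSubcubic →
        Graph.IncidenceChoosable.{w} G 6 ∧ Graph.incidenceChoiceNumber.{w} G ≤ 6) ∧
    (Graph.tripleEdge.Loopless ∧ Graph.tripleEdge.IsSubcubic ∧
      Graph.incidenceChoiceNumber.{w} Graph.tripleEdge = 6) := by
  refine ⟨fun G hV hG hG3 => ?_, Graph.tripleEdge_loopless, Graph.tripleEdge_isSubcubic,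
    le_antisymm ?_ ?_⟩
  · have h := Graph.incidenceChoosable_six.{w} hV hG hG3
    exact ⟨h, Graph.incidenceChoiceNumber_le h⟩
  · exact Graph.incidenceChoiceNumber_le (Graph.incidenceChoosable_six (Set.toFinite _)
      Graph.tripleEdge_loopless Graph.tripleEdge_isSubcubic)
  · exact le_iInf₂ fun k h => by
      exact_mod_cast Graph.six_le_of_incidenceChoosable_tripleEdge h
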